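/- **Lemma (Implementation Theorem for the RCAM).** *Calculus.* Let variables range over a countably infinite set and let $*$ be a special name that is not a variable. Bites are $b ::= xy \mid v$, crumbled values are $v ::= \lambda x.[*{\leftarrow}y] \mid \lambda x.E$, and environments are $E ::= \epsilon \mid E[z{\leftarrow}b]$, with $z$ a variable or $*$; $E[z{\leftarrow}b]$ binds $z$ in $E$. A crumble is an environment $[*{\leftarrow}b]E$; a v-environment, written $E_v$, is one whose entries are all values. The domain $\mathrm{dom}(E)$ is the set of left-hand sides of the entries of $E$, $\mathrm{fv}(E)$ is the set of free variables, $\mathrm{bv}(E)$ is the set of the variables abstracted by some $\lambda$ in $E$ (at any depth), and $E$ is closed if $\mathrm{fv}(E)=\emptyset$. $E$ is well-named if the entries of $\mathrm{dom}(E)$ are pairwise distinct, $\mathrm{dom}(E)\cap\mathrm{bv}(E)=\emptyset$, and $E=E_1[z{\leftarrow}b]E_2$ with $z$ a variable implies $z\notin \mathrm{fv}(b)\cup\mathrm{fv}(E_2)$. $E_v(x)$ is the value bound to $x$ in $E_v$. The reduction $\to_{Cr}\,=\,\to_{m_1}\cup\to_{m_2}$ is given by - $E_1[z{\leftarrow}xy]E_v\to_{m_1}E_1[z{\leftarrow}b']E'E_v$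 whenever some $\lambda x_1.[*{\leftarrow}b]E$ is obtained from $E_v(x)$ by $\alpha$-renaming, the variables of $\mathrm{dom}(E)$ do not occur in $E_1[z{\leftarrow}xy]E_v$, $([*{\leftarrow}b]E)\{x_1{\leftarrow}y\}=[*{\leftarrow}b']E'$ without capture of $y$ (no binder in $[*{\leftarrow}b]E$, at any depth, is $y$), and $E_1[z{\leftarrow}b']E'E_v$ is well-named; - $E_1[z{\leftarrow}xy]E_v\to_{m_2}E_1[z{\leftarrow}E_v(y_1')]E_v$ whenever $E_v(x)=\lambda x_1.[*{\leftarrow}y_1]$ and $y_1'=y_1\{x_1{\leftarrow}y\}$. *Machine.* States are triples $(E,E_v,H)$ of an active environment, an evaluated v-environment and a history stack $H ::= \epsilon\mid\langle\rangle:H\mid\langle x,y\rangle:H$. The initial state of $E$ is $\iota(E)=(E,\epsilon,\epsilon)$, the read-back of $(E,E_v,H)$ is the concatenation $EE_v$, and the forward transitions are - $(E_1[z{\leftarrow}v],E_v,H)\rightsquigarrow_{sea}(E_1,[z{\leftarrow}v]E_v,\langle\rangle:H)$, - $(E_1[z{\leftarrow}xy],E_v,H)\rightsquigarrow_{m_1}(E_1[z{\leftarrow}b']E',E_v,\langle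 x,y\rangle:H)$, with the side condition of $\to_{m_1}$, - $(E_1[z{\leftarrow}xy],E_v,H)\rightsquigarrow_{m_2}(E_1,[z{\leftarrow}E_v(y_1')]E_v,\langle x,y\rangle:H)$, with the side condition of $\to_{m_2}$. The principal transitions are $\rightsquigarrow_{m_1}$ and $\rightsquigarrow_{m_2}$; the overhead transition is $\rightsquigarrow_{sea}$. A state is *reachable* if it is reached by forward transitions from $\iota(E)$ for some closed well-named crumble $E$. States are taken up to $\alpha$-equivalence, the variables of the domain of $E_v$ being bound in $E_v$, in the active environment and in the history, and those of the domain of the active environment being bound in the active environment. *Claim.* The RCAM restricted to forward transitions (on reachable states), the reduction $\to_{Cr}$ and the read-back form an implementation system: 1. (Initialization) For every closed well-named crumble $E$, $\iota(E)$ is a reachable state and its read-back is $E$. 2. (Principal projection) If $S$ is reachable and $S\rightsquigarrow_{m_1}S'$ or $S\rightsquigarrow_{m_2}S'$, then the read-back of $S$ reduces by one $\to_{Cr}$-step to the read-back of $S'$. 3. (Overhead transparency) If $S$ is reachable and $S\rightsquigarrow_{sea}S'$, then $S$ and $S'$ have the same read-back. 4. (Determinism) Forward transitions are deterministic up to $\alpha$-equivalence: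 if $S_1,S_2$ are reachable and $\alpha$-equivalent and $S_1\rightsquigarrow S_1'$, $S_2\rightsquigarrow S_2'$ by forward transitions, then $S_1'$ and $S_2'$ are $\alpha$-equivalent. 5. (Halt) If $S$ is reachable and no forward transition applies to $S$, then the read-back of $S$ is $\to_{Cr}$-normal. 6. (Overhead termination) There is no infinite sequence of $\rightsquigarrow_{sea}$ transitions starting from a reachable state. -/

import Mathlib

namespace RCAM

/-! ## Syntax of the finest crumbled calculus -/

/-- Variables: a countably infinite set of names. -/
abbrev Var := ℕ

/-- The left-hand side of an explicit substitution: `none` is the special variable `*`,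
`some x` is the ordinary variable `x`. -/
abbrev Target := Option Var

mutual
/-- Bites: `x y`, the crumbled value `λ x. [* ← y]` and the crumbled value `λ x. E`. -/
inductive Bite : Type
  | app (x y : Var) : Bite
  | constAbs (x y : Var) : Bite
  | abs (x : Var) (E : Env) : Bite
/-- Environments: `ε` and `E [z ← b]`. -/
inductive Env : Type
  | nil : Env
  | snoc (E : Env) (z : Target) (b : Bite) : Env
end

/-- The crumbled values among the bites. -/
def Bite.IsValue : Bite → Prop
  | .app _ _ => False
  | .constAbs _ _ => True
  | .abs _ _ => True

/-- Concatenation `E₁ E₂`. -/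
def Env.append (E₁ : Env) : Env → Env
  | .nil => E₁
  | .snoc E₂ z b => .snoc (Env.append E₁ E₂) z b

/-- The one-entry environment `[z ← b]`. -/
def Env.single (z : Target) (b : Bite) : Env := .snoc .nil z b

/-- The environment `[z ← b] E`. -/
def Env.cons (z : Target) (b : Bite) (E : Env) : Env := (Env.single z b).append E

/-- A crumble is an environment of the form `[* ← b] E`. -/
def Env.IsCrumble (E : Env) : Prop := ∃ b E', E = Env.cons none b E'

/-- A v-environment: every entry is a crumbled value. -/
def Env.IsVEnv : Env → Prop
  | .nil => True
  | .snoc E _ b => E.IsVEnv ∧ b.IsValue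

/-- The domain, as the list of the targets from left to right. -/
def Env.dom : Env → List Target
  | .nil => []
  | .snoc E z _ => E.dom ++ [z]

/-- `E(x)`: the bite bound to `x` in `E` (the one that an occurrence of `x` on the left of `E`
refers to, i.e. the leftmost one, if there are several). -/
def Env.lookup (x : Var) : Env → Option Bite
  | .nil => none
  | .snoc E z b =>
    match E.lookup x with
    | some c => some c
    | none => if z = some x then some b else none

mutual
/-- Free variables of a bite. -/
def Bite.fv : Bite → Finset Var
  | .app x y => {x, y}
  | .constAbs x y => {y} \ {x}
  | .abs x E => E.fv \ {x}
/-- Free variables of an environment: `z` is bound in `E` by `E [z ← b]`. -/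
def Env.fv : Env → Finset Var
  | .nil => ∅
  | .snoc E z b => (E.fv \ z.toFinset) ∪ b.fv
end

mutual
/-- Bound variables of a bite. -/
def Bite.bv : Bite → Finset Var
  | .app _ _ => ∅
  | .constAbs x _ => {x}
  | .abs x E => {x} ∪ E.bv
/-- Bound variables of an environment: the variables abstracted by some `λ`, at any depth. -/
def Env.bv : Env → Finset Var
  | .nil => ∅
  | .snoc E _ b => E.bv ∪ b.bv
end

mutual
/-- The variables in binding position in a bite: abstracted by a `λ` or in the domain of a body. -/
def Bite.binders : Bite → Finset Var
  | .app _ _ => ∅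
  | .constAbs x _ => {x}
  | .abs x E => {x} ∪ E.binders
/-- The variables in binding position in an environment, at any depth. -/
def Env.binders : Env → Finset Var
  | .nil => ∅
  | .snoc E z b => E.binders ∪ z.toFinset ∪ b.binders
end

mutual
/-- All the variables that occur in a bite. -/
def Bite.vars : Bite → Finset Var
  | .app x y => {x, y}
  | .constAbs x y => {x, y}
  | .abs x E => {x} ∪ E.vars
/-- All the variables that occur in an environment. -/
def Env.vars : Env → Finset Var
  | .nil => ∅
  | .snoc E z b => E.vars ∪ z.toFinset ∪ b.vars
end

/-- An environment is closed if it has no free variable. -/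
def Env.IsClosed (E : Env) : Prop := E.fv = ∅

/-- Well-named environments. -/
structure Env.WellNamed (E : Env) : Prop where
  /-- the entries of the domain are pairwise distinct -/
  nodup : E.dom.Nodup
  /-- the domain and the bound variables are disjoint -/
  disjoint : ∀ x ∈ E.bv, some x ∉ E.dom
  /-- if `E = E₁ [z ← b] E₂` then `z ∉ fv(b) ∪ fv(E₂)` -/
  notMem_fv : ∀ (E₁ E₂ : Env) (z : Var) (b : Bite),
    E = (E₁.snoc (some z) b).append E₂ → z ∉ b.fv ∪ E₂.fv

/-! ## Substitution of a variable for a variable -/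

/-- `u {x ← y}` for a variable `u`. -/
def substVar (x y u : Var) : Var := if u = x then y else u

mutual
/-- `b {x ← y}`: every free occurrence of `x` in `b` is replaced by `y`. Bound variables are not
renamed, so this is the capture-avoiding substitution when `y ∉ b.binders`. -/
def Bite.subst (x y : Var) : Bite → Bite
  | .app u w => .app (substVar x y u) (substVar x y w)
  | .constAbs u w => if u = x then .constAbs u w else .constAbs u (substVar x y w)
  | .abs u E => if u = x then .abs u E else .abs u (E.subst x y)
/-- `E {x ← y}`; the entry `[z ← b]` of `E [z ← b]` binds `z` in `E`. -/
def Env.subst (x y : Var) : Env → Env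
  | .nil => .nil
  | .snoc E z b => .snoc (if z = some x then E else E.subst x y) z (b.subst x y)
end

/-! ## α-equivalence -/

/-- `VarEq Γ x y`: the occurrences `x` and `y` refer to the same binder when the binders that are
passed, the innermost first, are paired as listed in `Γ`; variables that are not bound in `Γ` have
to be equal. -/
def VarEq : List (Var × Var) → Var → Var → Prop
  | [], x, y => x = y
  | (a, b) :: Γ, x, y => (x = a ∧ y = b) ∨ (x ≠ a ∧ y ≠ b ∧ VarEq Γ x y)

mutual
/-- α-equivalence of bites below the paired binders `Γ`. -/
def Bite.AlphaUnder : Bite → List (Var × Var) → Bite → Prop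
  | .app x y, Γ, .app x' y' => VarEq Γ x x' ∧ VarEq Γ y y'
  | .constAbs x y, Γ, .constAbs x' y' => VarEq ((x, x') :: Γ) y y'
  | .abs x E, Γ, .abs x' E' => E.AlphaUnder ((x, x') :: Γ) E'
  | _, _, _ => False
/-- α-equivalence of environments below the paired binders `Γ`. In `E [z ← b]` the variable `z` is
bound in `E`, and not in `b`; the special variable `*` is not renamed. -/
def Env.AlphaUnder : Env → List (Var × Var) → Env → Prop
  | .nil, _, .nil => True
  | .snoc E none b, Γ, .snoc E' none b' => b.AlphaUnder Γ b' ∧ E.AlphaUnder Γ E'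
  | .snoc E (some z) b, Γ, .snoc E' (some z') b' =>
      b.AlphaUnder Γ b' ∧ E.AlphaUnder ((z, z') :: Γ) E'
  | _, _, _ => False
end

/-- α-equivalence of bites. -/
def Bite.AlphaEq (b b' : Bite) : Prop := b.AlphaUnder [] b'

/-- The pairing of the variables in the domains of two environments of the same shape, put in
front of `Γ`; the leftmost entry, which is the innermost binder, comes first. -/
def Env.pairing : Env → List (Var × Var) → Env → List (Var × Var)
  | .snoc E (some z) _, Γ, .snoc E' (some z') _ => E.pairing ((z, z') :: Γ) E'
  | .snoc E none _, Γ, .snoc E' none _ => E.pairing Γ E'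
  | _, Γ, _ => Γ

/-! ## Reduction of the finest crumbled calculus -/

/-- The side condition of the rule `m₁` on the environment `E₁ [z ← x y] Eᵥ`: some
`λ x₁. [* ← b] E` is obtained by α-renaming from `Eᵥ(x)`, the variables in the domain of `E` are
fresh, `([* ← b] E) {x₁ ← y} = [* ← b'] E'` without capture of `y`, and the resulting
environment `E₁ [z ← b'] E' Eᵥ` is well-named. -/
def M1Side (E₁ : Env) (z : Target) (x y : Var) (Ev : Env) (b' : Bite) (E' : Env) : Prop :=
  ∃ (v : Bite) (x₁ : Var) (b : Bite) (E : Env),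
    Ev.lookup x = some v ∧
    v.AlphaEq (.abs x₁ (Env.cons none b E)) ∧
    (∀ u : Var, some u ∈ E.dom → u ∉ ((E₁.snoc z (.app x y)).append Ev).vars) ∧
    y ∉ (Env.cons none b E).binders ∧
    (Env.cons none b E).subst x₁ y = Env.cons none b' E' ∧
    Env.WellNamed (((E₁.snoc z b').append E').append Ev)

/-- The side condition of the rule `m₂`: `Eᵥ(x) = λ x₁. [* ← y₁]`, `y₁' = y₁ {x₁ ← y}` and
`w = Eᵥ(y₁')`. -/
def M2Side (x y : Var) (Ev : Env) (w : Bite) : Prop :=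
  ∃ x₁ y₁ : Var, Ev.lookup x = some (.constAbs x₁ y₁) ∧ Ev.lookup (substVar x₁ y y₁) = some w

/-- `E₁ [z ← x y] Eᵥ →ₘ₁ E₁ [z ← b'] E' Eᵥ`. -/
inductive CrM1 : Env → Env → Prop
  | step (E₁ : Env) (z : Target) (x y : Var) (Ev : Env) (b' : Bite) (E' : Env) :
      Ev.IsVEnv → M1Side E₁ z x y Ev b' E' →
      CrM1 ((E₁.snoc z (.app x y)).append Ev) (((E₁.snoc z b').append E').append Ev)

/-- `E₁ [z ← x y] Eᵥ →ₘ₂ E₁ [z ← Eᵥ(y₁')] Eᵥ`. -/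
inductive CrM2 : Env → Env → Prop
  | step (E₁ : Env) (z : Target) (x y : Var) (Ev : Env) (w : Bite) :
      Ev.IsVEnv → M2Side x y Ev w →
      CrM2 ((E₁.snoc z (.app x y)).append Ev) ((E₁.snoc z w).append Ev)

/-- One step of the finest crumbled calculus. -/
def CrStep (E E' : Env) : Prop := CrM1 E E' ∨ CrM2 E E'

/-! ## The machine -/

/-- Entries of the history stack: `⟨⟩` and `⟨x, y⟩`. -/
inductive HistEntry : Type
  | search : HistEntry
  | principal (x y : Var) : HistEntry

/-- States `(E, Eᵥ, H)`; the head of the list `hist` is the top of the stack. -/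
structure State where
  active : Env
  evaluated : Env
  hist : List HistEntry

/-- The initial state `(E, ε, ε)`. -/
def initState (E : Env) : State := ⟨E, .nil, []⟩

/-- The read-back `E Eᵥ` of the state `(E, Eᵥ, H)`. -/
def readBack (S : State) : Env := S.active.append S.evaluated

/-- The forward search transition. -/
inductive Sea : State → State → Prop
  | step (E₁ : Env) (z : Target) (v : Bite) (Ev : Env) (H : List HistEntry) :
      Ev.IsVEnv → v.IsValue →
      Sea ⟨E₁.snoc z v, Ev, H⟩ ⟨E₁, Env.cons z v Ev, .search :: H⟩

/-- The forward transition `m₁`. -/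
inductive M1 : State → State → Prop
  | step (E₁ : Env) (z : Target) (x y : Var) (Ev : Env) (b' : Bite) (E' : Env)
      (H : List HistEntry) :
      Ev.IsVEnv → M1Side E₁ z x y Ev b' E' →
      M1 ⟨E₁.snoc z (.app x y), Ev, H⟩ ⟨(E₁.snoc z b').append E', Ev, .principal x y :: H⟩

/-- The forward transition `m₂`. -/
inductive M2 : State → State → Prop
  | step (E₁ : Env) (z : Target) (x y : Var) (Ev : Env) (w : Bite) (H : List HistEntry) :
      Ev.IsVEnv → M2Side x y Ev w →
      M2 ⟨E₁.snoc z (.app x y), Ev, H⟩ ⟨E₁, Env.cons z w Ev, .principal x y :: H⟩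

/-- The principal forward transitions. -/
def Principal (S S' : State) : Prop := M1 S S' ∨ M2 S S'

/-- The overhead forward transitions. -/
def Overhead (S S' : State) : Prop := Sea S S'

/-- The crumbles the machine is started on: closed and well-named. -/
def IsSource (E : Env) : Prop := E.IsCrumble ∧ E.IsClosed ∧ E.WellNamed

/-- States that are reachable, by forward transitions only, from the initial state of a closed
well-named crumble. -/
def FwdReachable (S : State) : Prop :=
  ∃ E : Env, IsSource E ∧
    Relation.ReflTransGen (fun S₁ S₂ => Principal S₁ S₂ ∨ Overhead S₁ S₂) (initState E) S

/-! ## α-equivalence of states -/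

/-- Two history entries agree up to the pairing `Γ` of variables. -/
def HistEntry.AlphaUnder (Γ : List (Var × Var)) : HistEntry → HistEntry → Prop
  | .search, .search => True
  | .principal x y, .principal x' y' => VarEq Γ x x' ∧ VarEq Γ y y'
  | _, _ => False

/-- α-equivalence of states: the variables in the domain of the evaluated environment are bound in
the evaluated environment, in the active environment and in the history. -/
def State.AlphaEq (S S' : State) : Prop :=
  S.evaluated.AlphaUnder [] S'.evaluated ∧
  S.active.AlphaUnder (S.evaluated.pairing [] S'.evaluated) S'.active ∧
  List.Forall₂ (HistEntry.AlphaUnder (S.evaluated.pairing [] S'.evaluated)) S.hist S'.hist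

theorem VarEq.refl (l : List Var) (x : Var) : VarEq (l.map fun a => (a, a)) x x := by
  induction l with
  | nil => rfl
  | cons a l ih =>
    by_cases h : x = a
    · exact Or.inl ⟨h, h⟩
    · exact Or.inr ⟨h, h, ih⟩

theorem VarEq.symm : ∀ {Γ : List (Var × Var)} {x y : Var}, VarEq Γ x y → VarEq (Γ.map Prod.swap) y x
  | [], _, _, h => Eq.symm h
  | (_, _) :: _, _, _, Or.inl h => Or.inl ⟨h.2, h.1⟩
  | (_, _) :: _, _, _, Or.inr h => Or.inr ⟨h.2.1, h.1, VarEq.symm h.2.2⟩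

/-- Two composable pairings, given as a list of triples. -/
theorem VarEq.trans : ∀ {T : List (Var × Var × Var)} {x y z : Var},
    VarEq (T.map fun t => (t.1, t.2.1)) x y → VarEq (T.map fun t => (t.2.1, t.2.2)) y z →
    VarEq (T.map fun t => (t.1, t.2.2)) x z
  | [], _, _, _, h, h' => Eq.trans h h'
  | (_, _, _) :: _, _, _, _, h, h' => by
    rcases h with h | h <;> rcases h' with h' | h'
    · exact Or.inl ⟨h.1, h'.2⟩
    · exact absurd h.2 h'.1
    · exact absurd h'.1 h.2.1
    · exact Or.inr ⟨h.1, h'.2.1, VarEq.trans h.2.2 h'.2.2⟩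

mutual
theorem Bite.AlphaUnder.refl : ∀ (b : Bite) (l : List Var), b.AlphaUnder (l.map fun a => (a, a)) b
  | .app x y, l => by
    rw [Bite.AlphaUnder]; exact ⟨VarEq.refl l x, VarEq.refl l y⟩
  | .constAbs x y, l => by
    rw [Bite.AlphaUnder]; exact VarEq.refl (x :: l) y
  | .abs x E, l => by
    rw [Bite.AlphaUnder]; exact Env.AlphaUnder.refl E (x :: l)
theorem Env.AlphaUnder.refl : ∀ (E : Env) (l : List Var), E.AlphaUnder (l.map fun a => (a, a)) E
  | .nil, _ => by rw [Env.AlphaUnder]; trivial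
  | .snoc E none b, l => by
    rw [Env.AlphaUnder]; exact ⟨Bite.AlphaUnder.refl b l, Env.AlphaUnder.refl E l⟩
  | .snoc E (some z) b, l => by
    rw [Env.AlphaUnder]; exact ⟨Bite.AlphaUnder.refl b l, Env.AlphaUnder.refl E (z :: l)⟩
end

mutual
theorem Bite.AlphaUnder.symm : ∀ {b b' : Bite} {Γ : List (Var × Var)},
    b.AlphaUnder Γ b' → b'.AlphaUnder (Γ.map Prod.swap) b
  | .app x y, .app x' y', Γ, h => by
    rw [Bite.AlphaUnder] at h ⊢; exact ⟨VarEq.symm h.1, VarEq.symm h.2⟩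
  | .constAbs x y, .constAbs x' y', Γ, h => by
    rw [Bite.AlphaUnder] at h ⊢; exact VarEq.symm h
  | .abs x E, .abs x' E', Γ, h => by
    rw [Bite.AlphaUnder] at h ⊢; exact Env.AlphaUnder.symm h
  | .app _ _, .constAbs _ _, _, h | .app _ _, .abs _ _, _, h | .constAbs _ _, .app _ _, _, h
  | .constAbs _ _, .abs _ _, _, h | .abs _ _, .app _ _, _, h | .abs _ _, .constAbs _ _, _, h => by
    simp [Bite.AlphaUnder] at h
theorem Env.AlphaUnder.symm : ∀ {E E' : Env} {Γ : List (Var × Var)},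
    E.AlphaUnder Γ E' → E'.AlphaUnder (Γ.map Prod.swap) E
  | .nil, .nil, _, _ => by rw [Env.AlphaUnder]; trivial
  | .snoc E none b, .snoc E' none b', Γ, h => by
    rw [Env.AlphaUnder] at h ⊢
    exact ⟨Bite.AlphaUnder.symm h.1, Env.AlphaUnder.symm h.2⟩
  | .snoc E (some z) b, .snoc E' (some z') b', Γ, h => by
    rw [Env.AlphaUnder] at h ⊢
    exact ⟨Bite.AlphaUnder.symm h.1, Env.AlphaUnder.symm h.2⟩
  | .nil, .snoc _ _ _, _, h | .snoc _ _ _, .nil, _, h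
  | .snoc _ none _, .snoc _ (some _) _, _, h | .snoc _ (some _) _, .snoc _ none _, _, h => by
    simp [Env.AlphaUnder] at h
end

mutual
theorem Bite.AlphaUnder.trans : ∀ {b c d : Bite} {T : List (Var × Var × Var)},
    b.AlphaUnder (T.map fun t => (t.1, t.2.1)) c → c.AlphaUnder (T.map fun t => (t.2.1, t.2.2)) d →
    b.AlphaUnder (T.map fun t => (t.1, t.2.2)) d
  | .app _ _, .app _ _, .app _ _, T, h, h' => by
    rw [Bite.AlphaUnder] at h h' ⊢; exact ⟨VarEq.trans h.1 h'.1, VarEq.trans h.2 h'.2⟩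
  | .constAbs x _, .constAbs y _, .constAbs z _, T, h, h' => by
    rw [Bite.AlphaUnder] at h h' ⊢; exact VarEq.trans (T := (x, y, z) :: T) h h'
  | .abs x E, .abs y F, .abs z G, T, h, h' => by
    rw [Bite.AlphaUnder] at h h' ⊢; exact Env.AlphaUnder.trans (T := (x, y, z) :: T) h h'
  | .app _ _, .constAbs _ _, _, _, h, _ | .app _ _, .abs _ _, _, _, h, _
  | .constAbs _ _, .app _ _, _, _, h, _ | .constAbs _ _, .abs _ _, _, _, h, _
  | .abs _ _, .app _ _, _, _, h, _ | .abs _ _, .constAbs _ _, _, _, h, _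
  | _, .app _ _, .constAbs _ _, _, _, h | _, .app _ _, .abs _ _, _, _, h
  | _, .constAbs _ _, .app _ _, _, _, h | _, .constAbs _ _, .abs _ _, _, _, h
  | _, .abs _ _, .app _ _, _, _, h | _, .abs _ _, .constAbs _ _, _, _, h => by
    simp [Bite.AlphaUnder] at h
theorem Env.AlphaUnder.trans : ∀ {E F G : Env} {T : List (Var × Var × Var)},
    E.AlphaUnder (T.map fun t => (t.1, t.2.1)) F → F.AlphaUnder (T.map fun t => (t.2.1, t.2.2)) G →
    E.AlphaUnder (T.map fun t => (t.1, t.2.2)) G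
  | .nil, .nil, .nil, _, _, _ => by rw [Env.AlphaUnder]; trivial
  | .snoc E none b, .snoc F none c, .snoc G none d, T, h, h' => by
    rw [Env.AlphaUnder] at h h' ⊢
    exact ⟨Bite.AlphaUnder.trans h.1 h'.1, Env.AlphaUnder.trans h.2 h'.2⟩
  | .snoc E (some x) b, .snoc F (some y) c, .snoc G (some z) d, T, h, h' => by
    rw [Env.AlphaUnder] at h h' ⊢
    exact ⟨Bite.AlphaUnder.trans h.1 h'.1, Env.AlphaUnder.trans (T := (x, y, z) :: T) h.2 h'.2⟩
  | .nil, .snoc _ _ _, _, _, h, _ | .snoc _ _ _, .nil, _, _, h, _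
  | .snoc _ none _, .snoc _ (some _) _, _, _, h, _
  | .snoc _ (some _) _, .snoc _ none _, _, _, h, _
  | _, .nil, .snoc _ _ _, _, _, h | _, .snoc _ _ _, .nil, _, _, h
  | _, .snoc _ none _, .snoc _ (some _) _, _, _, h
  | _, .snoc _ (some _) _, .snoc _ none _, _, _, h => by
    simp [Env.AlphaUnder] at h
end

theorem Env.pairing_refl : ∀ (E : Env) (l : List Var),
    ∃ l' : List Var, E.pairing (l.map fun a => (a, a)) E = l'.map fun a => (a, a)
  | .nil, l => ⟨l, rfl⟩
  | .snoc E none _, l => Env.pairing_refl E l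
  | .snoc E (some z) _, l => Env.pairing_refl E (z :: l)

theorem Env.pairing_symm : ∀ (E E' : Env) (Γ : List (Var × Var)),
    E'.pairing (Γ.map Prod.swap) E = (E.pairing Γ E').map Prod.swap
  | .nil, .nil, _ | .nil, .snoc _ none _, _ | .nil, .snoc _ (some _) _, _
  | .snoc _ none _, .nil, _ | .snoc _ (some _) _, .nil, _
  | .snoc _ none _, .snoc _ (some _) _, _ | .snoc _ (some _) _, .snoc _ none _, _ => rfl
  | .snoc E none _, .snoc E' none _, Γ => Env.pairing_symm E E' Γ
  | .snoc E (some z) _, .snoc E' (some z') _, Γ => Env.pairing_symm E E' ((z, z') :: Γ)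

theorem Env.pairing_trans : ∀ {E F G : Env} {Γ Δ : List (Var × Var)} (T : List (Var × Var × Var)),
    E.AlphaUnder Γ F → F.AlphaUnder Δ G → ∃ T' : List (Var × Var × Var),
      E.pairing (T.map fun t => (t.1, t.2.1)) F = T'.map (fun t => (t.1, t.2.1)) ∧
      F.pairing (T.map fun t => (t.2.1, t.2.2)) G = T'.map (fun t => (t.2.1, t.2.2)) ∧
      E.pairing (T.map fun t => (t.1, t.2.2)) G = T'.map (fun t => (t.1, t.2.2))
  | .nil, .nil, .nil, _, _, T, _, _ => ⟨T, rfl, rfl, rfl⟩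
  | .snoc E none b, .snoc F none c, .snoc G none d, _, _, T, h, h' => by
    rw [Env.AlphaUnder] at h h'
    exact Env.pairing_trans (E := E) (F := F) (G := G) T h.2 h'.2
  | .snoc E (some x) b, .snoc F (some y) c, .snoc G (some z) d, _, _, T, h, h' => by
    rw [Env.AlphaUnder] at h h'
    exact Env.pairing_trans (E := E) (F := F) (G := G) ((x, y, z) :: T) h.2 h'.2
  | .nil, .snoc _ _ _, _, _, _, _, h, _ | .snoc _ _ _, .nil, _, _, _, _, h, _
  | .snoc _ none _, .snoc _ (some _) _, _, _, _, _, h, _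
  | .snoc _ (some _) _, .snoc _ none _, _, _, _, _, h, _
  | _, .nil, .snoc _ _ _, _, _, _, _, h | _, .snoc _ _ _, .nil, _, _, _, _, h
  | _, .snoc _ none _, .snoc _ (some _) _, _, _, _, _, h
  | _, .snoc _ (some _) _, .snoc _ none _, _, _, _, _, h => by
    simp [Env.AlphaUnder] at h

theorem State.AlphaEq.refl (S : State) : S.AlphaEq S := by
  obtain ⟨l, hl⟩ := Env.pairing_refl S.evaluated []
  rw [List.map_nil] at hl
  refine ⟨Env.AlphaUnder.refl _ [], ?_, ?_⟩
  · rw [hl]; exact Env.AlphaUnder.refl _ l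
  · rw [hl, List.forall₂_same]
    rintro (_ | ⟨x, y⟩) _
    · trivial
    · exact ⟨VarEq.refl l x, VarEq.refl l y⟩

theorem State.AlphaEq.symm {S S' : State} (h : S.AlphaEq S') : S'.AlphaEq S := by
  obtain ⟨h₁, h₂, h₃⟩ := h
  have hp := Env.pairing_symm S.evaluated S'.evaluated []
  rw [List.map_nil] at hp
  refine ⟨Env.AlphaUnder.symm h₁, ?_, ?_⟩
  · rw [hp]; exact Env.AlphaUnder.symm h₂
  · rw [hp]
    refine List.Forall₂.flip (h₃.imp ?_)
    rintro (_ | ⟨x, y⟩) (_ | ⟨x', y'⟩) h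
    · trivial
    · exact h.elim
    · exact h.elim
    · exact ⟨VarEq.symm h.1, VarEq.symm h.2⟩

theorem HistEntry.AlphaUnder.trans {T : List (Var × Var × Var)} :
    ∀ {a b c : HistEntry}, a.AlphaUnder (T.map fun t => (t.1, t.2.1)) b →
      b.AlphaUnder (T.map fun t => (t.2.1, t.2.2)) c → a.AlphaUnder (T.map fun t => (t.1, t.2.2)) c
  | .search, .search, .search, _, _ => trivial
  | .principal _ _, .principal _ _, .principal _ _, h, h' =>
    ⟨VarEq.trans h.1 h'.1, VarEq.trans h.2 h'.2⟩

theorem State.AlphaEq.trans {S S' S'' : State} (h : S.AlphaEq S') (h' : S'.AlphaEq S'') :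
    S.AlphaEq S'' := by
  obtain ⟨h₁, h₂, h₃⟩ := h
  obtain ⟨h₁', h₂', h₃'⟩ := h'
  obtain ⟨T, e₁, e₂, e₃⟩ := Env.pairing_trans [] h₁ h₁'
  simp only [List.map_nil] at e₁ e₂ e₃
  rw [e₁] at h₂ h₃
  rw [e₂] at h₂' h₃'
  refine ⟨Env.AlphaUnder.trans (T := []) h₁ h₁', ?_, ?_⟩
  · rw [e₃]; exact Env.AlphaUnder.trans h₂ h₂'
  · rw [e₃]
    clear e₁ e₂ e₃ h₁ h₂ h₁' h₂'
    revert h₃'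
    generalize S''.hist = H''
    generalize S.hist = H, S'.hist = H' at h₃
    induction h₃ generalizing H'' with
    | nil => intro h; cases h; exact .nil
    | cons ha _ ih =>
      intro h
      cases h with
      | cons hb ht => exact .cons (HistEntry.AlphaUnder.trans ha hb) (ih _ ht)

/-- States up to α-equivalence. -/
def stateSetoid : Setoid State where
  r := State.AlphaEq
  iseqv := ⟨State.AlphaEq.refl, State.AlphaEq.symm, State.AlphaEq.trans⟩

/-! ## Implementation systems -/

/-- The machine with set of states `IsState`, principal transitions `principal` and overhead
transitions `overhead`, its states being taken up to the equivalence `equiv`, the calculus with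
set of terms `IsTerm` and reduction `red`, and the decoding `decode` form an implementation system,
with encoding `encode`. -/
structure IsImplementationSystem {T S : Type} (IsTerm : T → Prop) (red : T → T → Prop)
    (IsState : S → Prop) (equiv : Setoid S) (principal overhead : S → S → Prop)
    (encode : T → S) (decode : S → T) : Prop where
  initialization : ∀ t, IsTerm t → IsState (encode t) ∧ decode (encode t) = t
  principal_projection : ∀ s s', IsState s → principal s s' → red (decode s) (decode s')
  overhead_transparency : ∀ s s', IsState s → overhead s s' → decode s = decode s'
  /-- the transition relation, on states up to the equivalence, is deterministic -/
  determinism : ∀ s₁ s₂ s₁' s₂', IsState s₁ → IsState s₂ → equiv.r s₁ s₂ →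
    (principal s₁ s₁' ∨ overhead s₁ s₁') → (principal s₂ s₂' ∨ overhead s₂ s₂') →
    equiv.r s₁' s₂'
  /-- a state without transitions decodes to a normal term -/
  halt : ∀ s, IsState s → (∀ s', ¬ (principal s s' ∨ overhead s s')) → ∀ t, ¬ red (decode s) t
  /-- there is no infinite sequence of overhead transitions -/
  overhead_termination : ¬ ∃ f : ℕ → S, IsState (f 0) ∧ ∀ n, overhead (f n) (f (n + 1))

end RCAM

/-!
The machine and the calculus share the side conditions of their rules, so projection and halting
only concern how a read-back splits: in `E₁ [z ← x y] Eᵥ` with `Eᵥ` a v-environment, the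
application is the rightmost one, and it determines `E₁` and `Eᵥ` (`Env.append_app_inj`). Hence a
reduction step of the read-back is a step at the rightmost entry of the active environment, unless
this entry is a value (`State.exists_step_of_crStep`). Search shortens the active environment, so it
terminates.

Determinism up to α-equivalence is the substantial part. It rests on an invariant of the reachable
states (`State.Invariant`): the read-back is closed and well-named, and the variables of the history
belong to the domain of the evaluated environment. For two α-equivalent states, let `Γ` pair the
domains of the evaluated environments.

* By well-namedness, looking up paired variables yields bites that are α-equivalent below `Γ`
  (`Env.AlphaUnder.lookup`). This settles the `m₂` transitions.
* A single induction (`Bite.AlphaUnder.subst`, `Env.AlphaUnder.subst`) shows that substitution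
  without capture respects α-equivalence. It is stated for two pairings that agree on the free
  variables only, so that it also covers every extension of a pairing by fresh variables (the
  `mono` lemmas). It makes the bodies unfolded by two `m₁` transitions α-equivalent, and freshness
  of their domains allows the rest of the active environments to be compared below them.
* A target moved to the evaluated environment extends `Γ`. It is not captured in the history, whose
  variables are bound already (`State.AlphaEq.push`).
-/

namespace RCAM

/-! ### Concatenation -/

theorem Env.append_assoc (A B : Env) : ∀ C : Env, (A.append B).append C = A.append (B.append C)
  | .nil => rfl
  | .snoc C z b => by simp only [Env.append, Env.append_assoc A B C]

theorem Env.append_cons (A : Env) (z : Target) (b : Bite) (B : Env) :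
    A.append (Env.cons z b B) = (A.snoc z b).append B :=
  (Env.append_assoc A (Env.single z b) B).symm

theorem Env.dom_append (A : Env) : ∀ B : Env, (A.append B).dom = A.dom ++ B.dom
  | .nil => by simp [Env.append, Env.dom]
  | .snoc B z b => by simp [Env.append, Env.dom, Env.dom_append A B]

theorem Env.bv_append (A : Env) : ∀ B : Env, (A.append B).bv = A.bv ∪ B.bv
  | .nil => by simp [Env.append, Env.bv]
  | .snoc B z b => by simp [Env.append, Env.bv, Env.bv_append A B]

theorem Env.mem_fv_snoc {E : Env} {z : Target} {b : Bite} {a : Var} :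
    a ∈ (E.snoc z b).fv ↔ (a ∈ E.fv ∧ z ≠ some a) ∨ a ∈ b.fv := by
  simp [Env.fv, Option.mem_toFinset, Option.mem_def]

theorem Env.mem_fv_append (A : Env) (a : Var) :
    ∀ B : Env, a ∈ (A.append B).fv ↔ (a ∈ A.fv ∧ some a ∉ B.dom) ∨ a ∈ B.fv
  | .nil => by simp [Env.append, Env.dom, Env.fv]
  | .snoc B z b => by
    have ih := Env.mem_fv_append A a B
    simp only [Env.append, Env.mem_fv_snoc, ih, Env.dom, List.mem_append, List.mem_singleton,
      eq_comm (a := some a)]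
    tauto

theorem Env.isVEnv_append (A : Env) : ∀ B : Env, (A.append B).IsVEnv ↔ A.IsVEnv ∧ B.IsVEnv
  | .nil => by simp [Env.append, Env.IsVEnv]
  | .snoc B z b => by simp [Env.append, Env.IsVEnv, Env.isVEnv_append A B, and_assoc]

theorem Env.exists_eq_append_of_mem_dom {z : Target} : ∀ {E : Env}, z ∈ E.dom →
    ∃ (E₁ : Env) (b : Bite) (E₂ : Env), E = (E₁.snoc z b).append E₂
  | .nil, h => by simp [Env.dom] at h
  | .snoc E w c, h => by
    rw [Env.dom, List.mem_append, List.mem_singleton] at h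
    rcases h with h | rfl
    · obtain ⟨E₁, b, E₂, rfl⟩ := Env.exists_eq_append_of_mem_dom h
      exact ⟨E₁, b, E₂.snoc w c, rfl⟩
    · exact ⟨E, c, .nil, rfl⟩

theorem Env.exists_eq_append_of_lookup {x : Var} {b : Bite} : ∀ {E : Env}, E.lookup x = some b →
    ∃ E₁ E₂ : Env, E = (E₁.snoc (some x) b).append E₂
  | .nil, h => by simp [Env.lookup] at h
  | .snoc E w c, h => by
    rw [Env.lookup] at h
    split at h
    next d hd =>
      obtain rfl : d = b := by simpa using h
      obtain ⟨E₁, E₂, rfl⟩ := Env.exists_eq_append_of_lookup hd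
      exact ⟨E₁, E₂.snoc w c, rfl⟩
    next =>
      split at h
      next hw =>
        obtain rfl : c = b := by simpa using h
        exact ⟨E, .nil, by rw [hw]; rfl⟩
      next => simp at h

theorem Env.lookup_eq_none_iff {x : Var} : ∀ {E : Env}, E.lookup x = none ↔ some x ∉ E.dom
  | .nil => by simp [Env.lookup, Env.dom]
  | .snoc E w c => by
    have ih := Env.lookup_eq_none_iff (x := x) (E := E)
    rw [Env.lookup]
    split
    next d hd =>
      simp only [hd, reduceCtorEq, false_iff, not_not] at ih ⊢
      simp [Env.dom, ih]
    next hd =>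
      rw [hd] at ih
      simp only [true_iff] at ih
      by_cases hw : w = some x
      · simp [hw, Env.dom]
      · simp [hw, Env.dom, ih, eq_comm (a := some x)]

theorem Env.mem_dom_of_lookup {x : Var} {b : Bite} {E : Env} (h : E.lookup x = some b) :
    some x ∈ E.dom := by
  by_contra hx
  rw [Env.lookup_eq_none_iff.2 hx] at h
  simp at h

theorem Env.mem_fv_of_lookup {x a : Var} {b : Bite} {E : Env} (h : E.lookup x = some b)
    (ha : a ∈ b.fv) : a ∈ E.fv ∨ some a ∈ E.dom := by
  obtain ⟨E₁, E₂, rfl⟩ := Env.exists_eq_append_of_lookup h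
  rw [Env.mem_fv_append, Env.mem_fv_snoc, Env.dom_append, List.mem_append]
  tauto

theorem Env.IsVEnv.isValue_of_lookup {x : Var} {b : Bite} {E : Env} (hE : E.IsVEnv)
    (h : E.lookup x = some b) : b.IsValue := by
  obtain ⟨E₁, E₂, rfl⟩ := Env.exists_eq_append_of_lookup h
  exact (((Env.isVEnv_append _ _).1 hE).1).2

theorem Env.bv_subset_of_lookup {x : Var} {b : Bite} {E : Env}
    (h : E.lookup x = some b) : b.bv ⊆ E.bv := by
  obtain ⟨E₁, E₂, rfl⟩ := Env.exists_eq_append_of_lookup h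
  rw [Env.bv_append, Env.bv]
  intro a ha
  simp [ha]

/-- The rightmost entry that is not a value determines how an environment splits around it. -/
theorem Env.append_app_inj {A B : Env} {z w : Target} {x y u v : Var} :
    ∀ {C D : Env}, C.IsVEnv → D.IsVEnv →
      (A.snoc z (.app x y)).append C = (B.snoc w (.app u v)).append D →
      A = B ∧ z = w ∧ x = u ∧ y = v ∧ C = D
  | .nil, .nil, _, _, h => by simpa [Env.append] using h
  | .nil, .snoc D t d, _, hD, h => by
    simp only [Env.append, Env.snoc.injEq] at h
    exact absurd hD.2 (by simp [← h.2.2, Bite.IsValue])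
  | .snoc C s c, .nil, hC, _, h => by
    simp only [Env.append, Env.snoc.injEq] at h
    exact absurd hC.2 (by simp [h.2.2, Bite.IsValue])
  | .snoc C s c, .snoc D t d, hC, hD, h => by
    simp only [Env.append, Env.snoc.injEq] at h
    obtain ⟨h, rfl, rfl⟩ := h
    obtain ⟨rfl, rfl, rfl, rfl, rfl⟩ := Env.append_app_inj hC.1 hD.1 h
    simp

theorem Env.not_isVEnv_append_app {A : Env} {z : Target} {x y : Var} {C : Env} :
    ¬ ((A.snoc z (.app x y)).append C).IsVEnv := by
  rw [Env.isVEnv_append]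
  exact fun h => h.1.2

/-! ### Well-named environments -/

/-- No bite of the environment has a free variable that belongs to `L`, or that is the target of
its own entry or of an entry further left. Here `L` stands for the domain of an environment on the
left. -/
def Env.ScopedFrom (L : List Target) : Env → Prop
  | .nil => True
  | .snoc E z b => E.ScopedFrom L ∧ ∀ u, some u ∈ L ++ (E.dom ++ [z]) → u ∉ b.fv

theorem Env.scopedFrom_append (L : List Target) (A : Env) : ∀ B : Env,
    (A.append B).ScopedFrom L ↔ A.ScopedFrom L ∧ B.ScopedFrom (L ++ A.dom)
  | .nil => by simp [Env.append, Env.ScopedFrom]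
  | .snoc B z b => by
    simp only [Env.append, Env.ScopedFrom, Env.scopedFrom_append L A B, Env.dom_append,
      List.append_assoc, and_assoc]

theorem Env.ScopedFrom.notMem_fv {L : List Target} {u : Var} (hu : some u ∈ L) : ∀ {E : Env},
    E.ScopedFrom L → u ∉ E.fv
  | .nil, _ => by simp [Env.fv]
  | .snoc E z b, h => by
    rw [Env.mem_fv_snoc, not_or]
    exact ⟨fun h' => Env.ScopedFrom.notMem_fv hu h.1 h'.1, h.2 u (List.mem_append_left _ hu)⟩

theorem Env.ScopedFrom.notMem_fv_of_lookup {L : List Target} {u x : Var} {b : Bite} {E : Env}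
    (hu : some u ∈ L) (hE : E.ScopedFrom L) (h : E.lookup x = some b) : u ∉ b.fv := by
  obtain ⟨E₁, E₂, rfl⟩ := Env.exists_eq_append_of_lookup h
  exact ((Env.scopedFrom_append _ _ _).1 hE).1.2 u (List.mem_append_left _ hu)

theorem Env.scopedFrom_nil_of_nodup : ∀ {E : Env}, E.dom.Nodup →
    (∀ (E₁ E₂ : Env) (z : Var) (b : Bite),
      E = (E₁.snoc (some z) b).append E₂ → z ∉ b.fv ∪ E₂.fv) → E.ScopedFrom []
  | .nil, _, _ => trivial
  | .snoc E z b, hd, h => by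
    rw [Env.dom, List.nodup_append] at hd
    refine ⟨Env.scopedFrom_nil_of_nodup hd.1 ?_, ?_⟩
    · rintro E₁ E₂ w c rfl
      have hw := h E₁ (E₂.snoc z b) w c rfl
      rw [Finset.mem_union, Env.mem_fv_snoc] at hw
      have hne : z ≠ some w := fun e =>
        hd.2.2 (some w) (by simp [Env.dom_append, Env.dom]) z (by simp) e.symm
      rw [Finset.mem_union]
      tauto
    · intro u hu
      rw [List.nil_append, List.mem_append, List.mem_singleton] at hu
      rcases hu with hu | rfl
      · obtain ⟨E₁, c, E₂, rfl⟩ := Env.exists_eq_append_of_mem_dom hu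
        have := h E₁ (E₂.snoc z b) u c rfl
        rw [Finset.mem_union, Env.mem_fv_snoc] at this
        tauto
      · have := h E .nil u b rfl
        rw [Finset.mem_union] at this
        tauto

theorem Env.wellNamed_iff {E : Env} :
    E.WellNamed ↔ E.dom.Nodup ∧ (∀ x ∈ E.bv, some x ∉ E.dom) ∧ E.ScopedFrom [] := by
  refine ⟨fun h => ⟨h.1, h.2, Env.scopedFrom_nil_of_nodup h.1 h.3⟩, fun h => ⟨h.1, h.2.1, ?_⟩⟩
  rintro E₁ E₂ z b rfl
  have hs := (Env.scopedFrom_append _ _ _).1 h.2.2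
  rw [Finset.mem_union, not_or]
  exact ⟨hs.1.2 z (by simp), hs.2.notMem_fv (by simp [Env.dom])⟩

/-- Replacing an application by a bite that is bound in the environment on its right preserves
well-namedness. -/
theorem Env.WellNamed.replace_app {A : Env} {z : Target} {x y u : Var} {w : Bite} {Ev : Env}
    (h : ((A.snoc z (.app x y)).append Ev).WellNamed) (hw : Ev.lookup u = some w) :
    ((A.snoc z w).append Ev).WellNamed := by
  rw [Env.wellNamed_iff] at h ⊢
  obtain ⟨h₁, h₂, h₃⟩ := h
  rw [Env.scopedFrom_append] at h₃ ⊢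
  simp only [Env.dom_append, Env.dom] at h₁ h₂ h₃ ⊢
  refine ⟨h₁, fun a ha => h₂ a ?_, ⟨h₃.1.1, fun a ha => ?_⟩, h₃.2⟩
  · have := Env.bv_subset_of_lookup hw
    simp only [Env.bv_append, Env.bv, Finset.mem_union, Bite.bv] at ha ⊢
    grind
  · exact h₃.2.notMem_fv_of_lookup ha hw

/-! ### Paired variables -/

theorem VarEq.mem_iff {Γ : List (Var × Var)} {a c : Var} : ∀ {Θ : List (Var × Var)},
    VarEq (Θ ++ Γ) a c → (a ∈ Θ.map Prod.fst ↔ c ∈ Θ.map Prod.snd)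
  | [], _ => by simp
  | (p, q) :: Θ, h => by
    rcases h with ⟨rfl, rfl⟩ | ⟨h₁, h₂, h₃⟩
    · simp
    · simpa [h₁, h₂] using VarEq.mem_iff h₃

theorem varEq_append_iff {Γ : List (Var × Var)} {a c : Var} : ∀ {Θ : List (Var × Var)},
    a ∉ Θ.map Prod.fst → c ∉ Θ.map Prod.snd → (VarEq (Θ ++ Γ) a c ↔ VarEq Γ a c)
  | [], _, _ => Iff.rfl
  | (p, q) :: Θ, h, h' => by
    rw [List.map_cons, List.mem_cons, not_or] at h h'
    have ih := varEq_append_iff (Γ := Γ) h.2 h'.2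
    rw [List.cons_append, VarEq, ih]
    tauto

/-- Pairs of equal variables may be added as the outermost ones, where unpaired variables have to be
equal anyway. -/
theorem VarEq.append_diag {a c : Var} (l : List Var) : ∀ {Γ : List (Var × Var)},
    VarEq Γ a c → VarEq (Γ ++ l.map fun v => (v, v)) a c
  | [], h => by obtain rfl : a = c := h; exact VarEq.refl l a
  | _ :: _, Or.inl h => Or.inl h
  | _ :: _, Or.inr h => Or.inr ⟨h.1, h.2.1, VarEq.append_diag l h.2.2⟩

/-- The domains of α-equivalent environments are paired by some list `Θ`, whatever the pairing it is
put in front of. -/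
theorem Env.AlphaUnder.exists_pairing : ∀ {E E' : Env} {Γ : List (Var × Var)},
    E.AlphaUnder Γ E' → ∃ Θ : List (Var × Var), (∀ Δ, E.pairing Δ E' = Θ ++ Δ) ∧
      (∀ a, a ∈ Θ.map Prod.fst ↔ some a ∈ E.dom) ∧ (∀ a, a ∈ Θ.map Prod.snd ↔ some a ∈ E'.dom)
  | .nil, .nil, _, _ => ⟨[], fun _ => rfl, by simp [Env.dom], by simp [Env.dom]⟩
  | .snoc E none b, .snoc E' none b', _, h => by
    rw [Env.AlphaUnder] at h
    obtain ⟨Θ, h₁, h₂, h₃⟩ := Env.AlphaUnder.exists_pairing h.2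
    exact ⟨Θ, h₁, by simpa [Env.dom] using h₂, by simpa [Env.dom] using h₃⟩
  | .snoc E (some z) b, .snoc E' (some z') b', _, h => by
    rw [Env.AlphaUnder] at h
    obtain ⟨Θ, h₁, h₂, h₃⟩ := Env.AlphaUnder.exists_pairing h.2
    refine ⟨Θ ++ [(z, z')], fun Δ => by simp [Env.pairing, h₁], fun a => ?_, fun a => ?_⟩
    · rw [List.map_append, List.mem_append, h₂]; simp [Env.dom]
    · rw [List.map_append, List.mem_append, h₃]; simp [Env.dom]
  | .nil, .snoc _ _ _, _, h | .snoc _ _ _, .nil, _, h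
  | .snoc _ none _, .snoc _ (some _) _, _, h | .snoc _ (some _) _, .snoc _ none _, _, h => by
    simp [Env.AlphaUnder] at h

/-! ### α-equivalence, free variables and substitution -/

mutual
theorem Bite.AlphaUnder.append_diag (l : List Var) : ∀ {b b' : Bite} {Γ : List (Var × Var)},
    b.AlphaUnder Γ b' → b.AlphaUnder (Γ ++ l.map fun v => (v, v)) b'
  | .app x y, .app x' y', Γ, h => by
    rw [Bite.AlphaUnder] at h ⊢; exact ⟨h.1.append_diag l, h.2.append_diag l⟩
  | .constAbs x y, .constAbs x' y', Γ, h => by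
    rw [Bite.AlphaUnder] at h ⊢; exact h.append_diag l
  | .abs x E, .abs x' E', Γ, h => by
    rw [Bite.AlphaUnder] at h ⊢; exact Env.AlphaUnder.append_diag l h
  | .app _ _, .constAbs _ _, _, h | .app _ _, .abs _ _, _, h | .constAbs _ _, .app _ _, _, h
  | .constAbs _ _, .abs _ _, _, h | .abs _ _, .app _ _, _, h | .abs _ _, .constAbs _ _, _, h => by
    simp [Bite.AlphaUnder] at h
theorem Env.AlphaUnder.append_diag (l : List Var) : ∀ {E E' : Env} {Γ : List (Var × Var)},
    E.AlphaUnder Γ E' → E.AlphaUnder (Γ ++ l.map fun v => (v, v)) E'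
  | .nil, .nil, _, _ => by rw [Env.AlphaUnder]; trivial
  | .snoc E none b, .snoc E' none b', Γ, h => by
    rw [Env.AlphaUnder] at h ⊢
    exact ⟨Bite.AlphaUnder.append_diag l h.1, Env.AlphaUnder.append_diag l h.2⟩
  | .snoc E (some z) b, .snoc E' (some z') b', Γ, h => by
    rw [Env.AlphaUnder] at h ⊢
    exact ⟨Bite.AlphaUnder.append_diag l h.1, Env.AlphaUnder.append_diag l h.2⟩
  | .nil, .snoc _ _ _, _, h | .snoc _ _ _, .nil, _, h
  | .snoc _ none _, .snoc _ (some _) _, _, h | .snoc _ (some _) _, .snoc _ none _, _, h => by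
    simp [Env.AlphaUnder] at h
end

/-- Two bites that are α-equivalent below `Γ` stay so after each is replaced by an α-equivalent
one. -/
theorem Bite.AlphaUnder.congr {b b' c c' : Bite} {Γ : List (Var × Var)} (h : b.AlphaUnder Γ b')
    (hc : b.AlphaEq c) (hc' : b'.AlphaEq c') : c.AlphaUnder Γ c' := by
  have h₁ := Bite.AlphaUnder.append_diag (Γ.map Prod.fst) (Bite.AlphaUnder.symm hc)
  have h₂ := Bite.AlphaUnder.append_diag (Γ.map Prod.snd) hc'
  have h₃ := Bite.AlphaUnder.trans (T := Γ.map fun p => (p.1, p.1, p.2)) (b := c) (c := b) (d := b')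
    (by simpa [Function.comp_def] using h₁) (by simpa [Function.comp_def] using h)
  have h₄ := Bite.AlphaUnder.trans (T := Γ.map fun p => (p.1, p.2, p.2)) (b := c) (c := b') (d := c')
    (by simpa [Function.comp_def] using h₃) (by simpa [Function.comp_def] using h₂)
  simpa [Function.comp_def] using h₄

mutual
theorem Bite.AlphaUnder.exists_mem_fv : ∀ {b b' : Bite} {Γ : List (Var × Var)},
    b.AlphaUnder Γ b' → ∀ c ∈ b'.fv, ∃ a ∈ b.fv, VarEq Γ a c
  | .app x y, .app x' y', Γ, h => by
    rw [Bite.AlphaUnder] at h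
    simp only [Bite.fv, Finset.mem_insert, Finset.mem_singleton]
    rintro c (rfl | rfl)
    · exact ⟨x, by simp, h.1⟩
    · exact ⟨y, by simp, h.2⟩
  | .constAbs x y, .constAbs x' y', Γ, h => by
    rw [Bite.AlphaUnder, VarEq] at h
    simp only [Bite.fv, Finset.mem_sdiff, Finset.mem_singleton]
    rintro c ⟨rfl, hc⟩
    exact ⟨y, by tauto, by tauto⟩
  | .abs x E, .abs x' E', Γ, h => by
    rw [Bite.AlphaUnder] at h
    simp only [Bite.fv, Finset.mem_sdiff, Finset.mem_singleton]
    rintro c ⟨hc, hcx⟩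
    obtain ⟨a, ha, hac⟩ := Env.AlphaUnder.exists_mem_fv h c hc
    rw [VarEq] at hac
    exact ⟨a, ⟨ha, by tauto⟩, by tauto⟩
  | .app _ _, .constAbs _ _, _, h | .app _ _, .abs _ _, _, h | .constAbs _ _, .app _ _, _, h
  | .constAbs _ _, .abs _ _, _, h | .abs _ _, .app _ _, _, h | .abs _ _, .constAbs _ _, _, h => by
    simp [Bite.AlphaUnder] at h
theorem Env.AlphaUnder.exists_mem_fv : ∀ {E E' : Env} {Γ : List (Var × Var)},
    E.AlphaUnder Γ E' → ∀ c ∈ E'.fv, ∃ a ∈ E.fv, VarEq Γ a c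
  | .nil, .nil, _, _ => by simp [Env.fv]
  | .snoc E none b, .snoc E' none b', Γ, h => by
    rw [Env.AlphaUnder] at h
    intro c hc
    rw [Env.mem_fv_snoc] at hc
    rcases hc with hc | hc
    · obtain ⟨a, ha, hac⟩ := Env.AlphaUnder.exists_mem_fv h.2 c hc.1
      exact ⟨a, Env.mem_fv_snoc.2 (Or.inl ⟨ha, by simp⟩), hac⟩
    · obtain ⟨a, ha, hac⟩ := Bite.AlphaUnder.exists_mem_fv h.1 c hc
      exact ⟨a, Env.mem_fv_snoc.2 (Or.inr ha), hac⟩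
  | .snoc E (some z) b, .snoc E' (some z') b', Γ, h => by
    rw [Env.AlphaUnder] at h
    intro c hc
    rw [Env.mem_fv_snoc] at hc
    rcases hc with ⟨hc, hcz⟩ | hc
    · obtain ⟨a, ha, hac⟩ := Env.AlphaUnder.exists_mem_fv h.2 c hc
      rw [VarEq] at hac
      simp only [ne_eq, Option.some.injEq] at hcz
      exact ⟨a, Env.mem_fv_snoc.2 (Or.inl ⟨ha, by grind⟩), by grind⟩
    · obtain ⟨a, ha, hac⟩ := Bite.AlphaUnder.exists_mem_fv h.1 c hc
      exact ⟨a, Env.mem_fv_snoc.2 (Or.inr ha), hac⟩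
  | .nil, .snoc _ _ _, _, h | .snoc _ _ _, .nil, _, h
  | .snoc _ none _, .snoc _ (some _) _, _, h | .snoc _ (some _) _, .snoc _ none _, _, h => by
    simp [Env.AlphaUnder] at h
end

theorem substVar_self (x u : Var) : substVar x x u = u := by
  unfold substVar; split <;> simp_all

mutual
theorem Bite.subst_self (x : Var) : ∀ b : Bite, b.subst x x = b
  | .app u w => by simp [Bite.subst, substVar_self]
  | .constAbs u w => by simp [Bite.subst, substVar_self]
  | .abs u E => by simp [Bite.subst, Env.subst_self x E]
theorem Env.subst_self (x : Var) : ∀ E : Env, E.subst x x = E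
  | .nil => by simp [Env.subst]
  | .snoc E z b => by simp [Env.subst, Env.subst_self x E, Bite.subst_self x b]
end

/-- Stopping the substitution of `y` for `x` below a binder `u = x` amounts to substituting `x` for
itself there. -/
theorem Env.ite_subst (x y u : Var) (E : Env) :
    (if u = x then E else E.subst x y) = E.subst x (if u = x then x else y) := by
  split <;> simp [Env.subst_self]

theorem Env.dom_subst (x y : Var) : ∀ E : Env, (E.subst x y).dom = E.dom
  | .nil => by simp [Env.subst]
  | .snoc E z b => by
    rw [Env.subst, Env.dom, Env.dom]
    split
    · rfl
    · rw [Env.dom_subst x y E]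

theorem substVar_mem {x y a u : Var} (h : a = substVar x y u) : a = y ∨ (a = u ∧ a ≠ x) := by
  unfold substVar at h; split at h
  · exact Or.inl h
  · subst h; tauto

mutual
theorem Bite.mem_fv_subst {x y a : Var} : ∀ {b : Bite},
    a ∈ (b.subst x y).fv → a = y ∨ (a ∈ b.fv ∧ a ≠ x)
  | .app u w, h => by
    simp only [Bite.subst, Bite.fv, Finset.mem_insert, Finset.mem_singleton] at h ⊢
    rcases h with h | h <;> rcases substVar_mem h with h | h <;> tauto
  | .constAbs u w, h => by
    rw [Bite.subst] at h
    split at h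
    · simp only [Bite.fv, Finset.mem_sdiff, Finset.mem_singleton] at h ⊢
      grind
    · simp only [Bite.fv, Finset.mem_sdiff, Finset.mem_singleton] at h ⊢
      rcases substVar_mem h.1 with h' | h' <;> tauto
  | .abs u E, h => by
    rw [Bite.subst] at h
    split at h
    · simp only [Bite.fv, Finset.mem_sdiff, Finset.mem_singleton] at h ⊢
      grind
    · simp only [Bite.fv, Finset.mem_sdiff, Finset.mem_singleton] at h ⊢
      rcases Env.mem_fv_subst h.1 with h' | h' <;> tauto
theorem Env.mem_fv_subst {x y a : Var} : ∀ {E : Env},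
    a ∈ (E.subst x y).fv → a = y ∨ (a ∈ E.fv ∧ a ≠ x)
  | .nil, h => by simp [Env.subst, Env.fv] at h
  | .snoc E z b, h => by
    rw [Env.subst, Env.mem_fv_snoc] at h
    rw [Env.mem_fv_snoc]
    rcases h with ⟨h, hz⟩ | h
    · split at h
      · grind
      · rcases Env.mem_fv_subst h with h' | h' <;> tauto
    · rcases Bite.mem_fv_subst h with h' | h' <;> tauto
end

/-- The step below a pair of binders in the proof that substitution respects α-equivalence. -/
theorem VarEq.subst_cons {Γ Δ : List (Var × Var)} {x y x' y' u u' : Var} {s s' : Finset Var}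
    (hu : x = y ∨ y ≠ u) (hu' : x' = y' ∨ y' ≠ u')
    (H : ∀ a ∈ s, a ≠ u → ∀ c ∈ s', c ≠ u' → VarEq Γ a c →
      VarEq Δ (substVar x y a) (substVar x' y' c)) :
    ∀ a ∈ s, ∀ c ∈ s', VarEq ((u, u') :: Γ) a c →
      VarEq ((u, u') :: Δ) (substVar x (if u = x then x else y) a)
        (substVar x' (if u' = x' then x' else y') c) := by
  have key : ∀ {x y u a : Var}, (x = y ∨ y ≠ u) → a ≠ u →
      substVar x (if u = x then x else y) a = substVar x y a ∧ substVar x y a ≠ u := by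
    intro x y u a h ha
    unfold substVar
    grind
  rintro a ha c hc (⟨rfl, rfl⟩ | ⟨hau, hcu, hac⟩)
  · left
    unfold substVar
    constructor <;> grind
  · right
    rw [(key hu hau).1, (key hu' hcu).1]
    exact ⟨(key hu hau).2, (key hu' hcu).2, H a ha hau c hc hcu hac⟩

theorem eq_ite_or {x y u : Var} {s t : Finset Var} (h : x = y ∨ y ∉ s) (hts : t ⊆ s) :
    x = (if u = x then x else y) ∨ (if u = x then x else y) ∉ t := by
  split
  · exact Or.inl rfl
  · exact h.imp id fun hy hy' => hy (hts hy')

mutual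
/-- Substitution without capture respects α-equivalence, below pairings `Γ` and `Δ` that agree on
the free variables up to the substitution. The case `x = y`, `x' = y'` says that the pairing may be
replaced by any other one that agrees with it on the free variables. -/
theorem Bite.AlphaUnder.subst : ∀ {b b' : Bite} {Γ Δ : List (Var × Var)} {x y x' y' : Var},
    b.AlphaUnder Γ b' → (x = y ∨ y ∉ b.binders) → (x' = y' ∨ y' ∉ b'.binders) →
    (∀ a ∈ b.fv, ∀ c ∈ b'.fv, VarEq Γ a c → VarEq Δ (substVar x y a) (substVar x' y' c)) →
    (b.subst x y).AlphaUnder Δ (b'.subst x' y')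
  | .app u w, .app u' w', Γ, Δ, x, y, x', y', h, _, _, H => by
    rw [Bite.AlphaUnder] at h
    rw [Bite.subst, Bite.subst, Bite.AlphaUnder]
    exact ⟨H _ (by simp [Bite.fv]) _ (by simp [Bite.fv]) h.1,
      H _ (by simp [Bite.fv]) _ (by simp [Bite.fv]) h.2⟩
  | .constAbs u w, .constAbs u' w', Γ, Δ, x, y, x', y', h, hy, hy', H => by
    rw [Bite.AlphaUnder] at h
    have e : ∀ x y u w : Var, Bite.subst x y (.constAbs u w) =
        .constAbs u (substVar x (if u = x then x else y) w) := by
      intro x y u w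
      rw [Bite.subst]
      split <;> simp [substVar_self]
    rw [e, e, Bite.AlphaUnder]
    refine VarEq.subst_cons (s := {w}) (s' := {w'}) ?_ ?_ ?_ w (by simp) w' (by simp) h
    · simpa [Bite.binders] using hy
    · simpa [Bite.binders] using hy'
    · intro a ha hau c hc hcu
      exact H a (by simp_all [Bite.fv]) c (by simp_all [Bite.fv])
  | .abs u E, .abs u' E', Γ, Δ, x, y, x', y', h, hy, hy', H => by
    rw [Bite.AlphaUnder] at h
    have e : ∀ (x y u : Var) (E : Env), Bite.subst x y (.abs u E) =
        .abs u (E.subst x (if u = x then x else y)) := by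
      intro x y u w
      rw [Bite.subst, ← Env.ite_subst]
      split <;> rfl
    rw [e, e, Bite.AlphaUnder]
    rw [Bite.binders] at hy hy'
    refine Env.AlphaUnder.subst h (eq_ite_or hy Finset.subset_union_right)
      (eq_ite_or hy' Finset.subset_union_right) (VarEq.subst_cons ?_ ?_ ?_)
    · grind
    · grind
    · intro a ha hau c hc hcu
      exact H a (by simp_all [Bite.fv]) c (by simp_all [Bite.fv])
  | .app _ _, .constAbs _ _, _, _, _, _, _, _, h, _, _, _
  | .app _ _, .abs _ _, _, _, _, _, _, _, h, _, _, _
  | .constAbs _ _, .app _ _, _, _, _, _, _, _, h, _, _, _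
  | .constAbs _ _, .abs _ _, _, _, _, _, _, _, h, _, _, _
  | .abs _ _, .app _ _, _, _, _, _, _, _, h, _, _, _
  | .abs _ _, .constAbs _ _, _, _, _, _, _, _, h, _, _, _ => by
    simp [Bite.AlphaUnder] at h
theorem Env.AlphaUnder.subst : ∀ {E E' : Env} {Γ Δ : List (Var × Var)} {x y x' y' : Var},
    E.AlphaUnder Γ E' → (x = y ∨ y ∉ E.binders) → (x' = y' ∨ y' ∉ E'.binders) →
    (∀ a ∈ E.fv, ∀ c ∈ E'.fv, VarEq Γ a c → VarEq Δ (substVar x y a) (substVar x' y' c)) →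
    (E.subst x y).AlphaUnder Δ (E'.subst x' y')
  | .nil, .nil, _, _, _, _, _, _, _, _, _, _ => by
    rw [Env.subst, Env.subst, Env.AlphaUnder]; trivial
  | .snoc E none b, .snoc E' none b', Γ, Δ, x, y, x', y', h, hy, hy', H => by
    rw [Env.AlphaUnder] at h
    rw [Env.subst, Env.subst, if_neg (by simp), if_neg (by simp), Env.AlphaUnder]
    simp only [Env.binders, Option.toFinset_none, Finset.union_empty, Finset.mem_union,
      not_or] at hy hy'
    refine ⟨Bite.AlphaUnder.subst h.1 (by tauto) (by tauto) ?_,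
      Env.AlphaUnder.subst h.2 (by tauto) (by tauto) ?_⟩
    · exact fun a ha c hc => H a (Env.mem_fv_snoc.2 (.inr ha)) c (Env.mem_fv_snoc.2 (.inr hc))
    · exact fun a ha c hc => H a (Env.mem_fv_snoc.2 (.inl ⟨ha, by simp⟩)) c
        (Env.mem_fv_snoc.2 (.inl ⟨hc, by simp⟩))
  | .snoc E (some z) b, .snoc E' (some z') b', Γ, Δ, x, y, x', y', h, hy, hy', H => by
    rw [Env.AlphaUnder] at h
    rw [Env.subst, Env.subst]
    simp only [Option.some.injEq, Env.ite_subst]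
    rw [Env.AlphaUnder]
    simp only [Env.binders, Option.toFinset_some, Finset.mem_union, Finset.mem_singleton,
      not_or] at hy hy'
    refine ⟨Bite.AlphaUnder.subst h.1 (by tauto) (by tauto) ?_,
      Env.AlphaUnder.subst h.2 (eq_ite_or (s := E.binders) (by tauto) subset_rfl)
        (eq_ite_or (s := E'.binders) (by tauto) subset_rfl)
        (VarEq.subst_cons (by tauto) (by tauto) ?_)⟩
    · exact fun a ha c hc => H a (Env.mem_fv_snoc.2 (.inr ha)) c (Env.mem_fv_snoc.2 (.inr hc))
    · exact fun a ha hau c hc hcu => H a (Env.mem_fv_snoc.2 (.inl ⟨ha, by simpa using hau.symm⟩)) c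
        (Env.mem_fv_snoc.2 (.inl ⟨hc, by simpa using hcu.symm⟩))
  | .nil, .snoc _ _ _, _, _, _, _, _, _, h, _, _, _
  | .snoc _ _ _, .nil, _, _, _, _, _, _, h, _, _, _
  | .snoc _ none _, .snoc _ (some _) _, _, _, _, _, _, _, h, _, _, _
  | .snoc _ (some _) _, .snoc _ none _, _, _, _, _, _, _, h, _, _, _ => by
    simp [Env.AlphaUnder] at h
end

theorem Bite.AlphaUnder.mono {b b' : Bite} {Γ Δ : List (Var × Var)} (h : b.AlphaUnder Γ b')
    (H : ∀ a ∈ b.fv, ∀ c ∈ b'.fv, VarEq Γ a c → VarEq Δ a c) : b.AlphaUnder Δ b' := by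
  have := Bite.AlphaUnder.subst (Δ := Δ) (x := 0) (y := 0) (x' := 0) (y' := 0) h
    (.inl rfl) (.inl rfl) (by simpa only [substVar_self] using H)
  simpa only [Bite.subst_self] using this

theorem Env.AlphaUnder.mono {E E' : Env} {Γ Δ : List (Var × Var)} (h : E.AlphaUnder Γ E')
    (H : ∀ a ∈ E.fv, ∀ c ∈ E'.fv, VarEq Γ a c → VarEq Δ a c) : E.AlphaUnder Δ E' := by
  have := Env.AlphaUnder.subst (Δ := Δ) (x := 0) (y := 0) (x' := 0) (y' := 0) h
    (.inl rfl) (.inl rfl) (by simpa only [substVar_self] using H)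
  simpa only [Env.subst_self] using this

mutual
theorem Bite.fv_subset_vars : ∀ b : Bite, b.fv ⊆ b.vars
  | .app x y => subset_rfl
  | .constAbs x y => fun a ha => by simp_all [Bite.fv, Bite.vars]
  | .abs x E => fun a ha => by
    have : a ∈ E.fv → a ∈ E.vars := fun h => Env.fv_subset_vars E h
    simp_all [Bite.fv, Bite.vars]
theorem Env.fv_subset_vars : ∀ E : Env, E.fv ⊆ E.vars
  | .nil => by simp [Env.fv]
  | .snoc E z b => fun a ha => by
    have h₁ : a ∈ E.fv → a ∈ E.vars := fun h => Env.fv_subset_vars E h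
    have h₂ : a ∈ b.fv → a ∈ b.vars := fun h => Bite.fv_subset_vars b h
    rw [Env.mem_fv_snoc] at ha
    rw [Env.vars, Finset.mem_union, Finset.mem_union]
    tauto
end

theorem Env.vars_subset_append (A : Env) : ∀ B : Env, A.vars ⊆ (A.append B).vars
  | .nil => subset_rfl
  | .snoc B z b => fun a ha => by
    rw [Env.append, Env.vars]
    simp [Env.vars_subset_append A B ha]

/-! ### α-equivalence of concatenations and of bound values -/

theorem Env.AlphaUnder.append {A A' : Env} : ∀ {B B' : Env} {Γ : List (Var × Var)},
    B.AlphaUnder Γ B' → A.AlphaUnder (B.pairing Γ B') A' →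
    (A.append B).AlphaUnder Γ (A'.append B') ∧
      (A.append B).pairing Γ (A'.append B') = A.pairing (B.pairing Γ B') A'
  | .nil, .nil, _, _, h => ⟨h, rfl⟩
  | .snoc B none b, .snoc B' none b', Γ, hB, h => by
    rw [Env.AlphaUnder] at hB
    have ih := Env.AlphaUnder.append hB.2 h
    refine ⟨?_, ih.2⟩
    rw [Env.append, Env.append, Env.AlphaUnder]
    exact ⟨hB.1, ih.1⟩
  | .snoc B (some z) b, .snoc B' (some z') b', Γ, hB, h => by
    rw [Env.AlphaUnder] at hB
    have ih := Env.AlphaUnder.append hB.2 h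
    refine ⟨?_, ih.2⟩
    rw [Env.append, Env.append, Env.AlphaUnder]
    exact ⟨hB.1, ih.1⟩
  | .nil, .snoc _ _ _, _, h, _ | .snoc _ _ _, .nil, _, h, _
  | .snoc _ none _, .snoc _ (some _) _, _, h, _ | .snoc _ (some _) _, .snoc _ none _, _, h, _ => by
    simp [Env.AlphaUnder] at h

theorem Env.cons_ne_nil (z : Target) (b : Bite) : ∀ E : Env, Env.cons z b E ≠ .nil
  | .nil => by simp [Env.cons, Env.single, Env.append]
  | .snoc E w c => by simp [Env.cons, Env.append]

theorem Env.not_alphaUnder_nil_cons (z : Target) (b : Bite) (Γ : List (Var × Var)) (E : Env) :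
    ¬ Env.nil.AlphaUnder Γ (Env.cons z b E) := by
  have := Env.cons_ne_nil z b E
  generalize Env.cons z b E = F at this
  cases F <;> simp_all [Env.AlphaUnder]

theorem Env.not_alphaUnder_cons_nil (z : Target) (b : Bite) (Γ : List (Var × Var)) (E : Env) :
    ¬ (Env.cons z b E).AlphaUnder Γ .nil := by
  have := Env.cons_ne_nil z b E
  generalize Env.cons z b E = F at this
  cases F <;> simp_all [Env.AlphaUnder]

/-- α-equivalent crumbles have α-equivalent environments and, below these, α-equivalent first
bites. -/
theorem Env.AlphaUnder.of_cons_none {b b' : Bite} : ∀ {E E' : Env} {Γ : List (Var × Var)},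
    (Env.cons none b E).AlphaUnder Γ (Env.cons none b' E') →
      E.AlphaUnder Γ E' ∧ b.AlphaUnder (E.pairing Γ E') b'
  | .nil, .nil, _, h => by
    simp only [Env.cons, Env.single, Env.append, Env.AlphaUnder] at h
    simp only [Env.AlphaUnder, Env.pairing]
    exact ⟨trivial, h.1⟩
  | .snoc B none c, .snoc B' none c', Γ, h => by
    rw [Env.cons, Env.cons, Env.append, Env.append, Env.AlphaUnder] at h
    have ih := Env.AlphaUnder.of_cons_none h.2
    rw [Env.AlphaUnder]
    exact ⟨⟨h.1, ih.1⟩, ih.2⟩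
  | .snoc B (some z) c, .snoc B' (some z') c', Γ, h => by
    rw [Env.cons, Env.cons, Env.append, Env.append, Env.AlphaUnder] at h
    have ih := Env.AlphaUnder.of_cons_none h.2
    rw [Env.AlphaUnder]
    exact ⟨⟨h.1, ih.1⟩, ih.2⟩
  | .snoc _ none _, .snoc _ (some _) _, _, h | .snoc _ (some _) _, .snoc _ none _, _, h => by
    simp [Env.cons, Env.append, Env.AlphaUnder] at h
  | .nil, .snoc B none c, Γ, h => by
    change (Env.nil.snoc none b).AlphaUnder Γ ((Env.cons none b' B).snoc none c) at h
    rw [Env.AlphaUnder] at h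
    exact absurd h.2 (Env.not_alphaUnder_nil_cons _ _ _ _)
  | .snoc B none c, .nil, Γ, h => by
    change ((Env.cons none b B).snoc none c).AlphaUnder Γ (Env.nil.snoc none b') at h
    rw [Env.AlphaUnder] at h
    exact absurd h.2 (Env.not_alphaUnder_cons_nil _ _ _ _)
  | .nil, .snoc B (some _) c, Γ, h | .snoc B (some _) c, .nil, Γ, h => by
    simp [Env.cons, Env.append, Env.single, Env.AlphaUnder] at h

/-- Paired variables of α-equivalent environments are bound to α-equivalent bites. These are
compared below all the pairs of the domains, since by well-namedness the targets on the left of an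
entry do not occur free in it. -/
theorem Env.AlphaUnder.lookup {L L' : List Target} {x x' : Var} {v v' : Bite} :
    ∀ {E E' : Env} {Γ : List (Var × Var)}, E.AlphaUnder Γ E' → E.ScopedFrom L → E'.ScopedFrom L' →
      VarEq (E.pairing Γ E') x x' → E.lookup x = some v → E'.lookup x' = some v' →
      v.AlphaUnder (E.pairing Γ E') v'
  | .nil, _, _, _, _, _, _, hv, _ => by simp [Env.lookup] at hv
  | .snoc E none b, .snoc E' none b', Γ, h, hs, hs', hx, hv, hv' => by
    rw [Env.AlphaUnder] at h
    rw [Env.lookup] at hv hv'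
    refine Env.AlphaUnder.lookup (E := E) (E' := E') h.2 hs.1 hs'.1 hx ?_ ?_
    · split at hv <;> simp_all
    · split at hv' <;> simp_all
  | .snoc E (some z) b, .snoc E' (some z') b', Γ, h, hs, hs', hx, hv, hv' => by
    rw [Env.AlphaUnder] at h
    rw [Env.pairing] at hx ⊢
    obtain ⟨Θ, h₁, h₂, h₃⟩ := h.2.exists_pairing
    by_cases hE : some x ∈ E.dom
    · have hE' : some x' ∈ E'.dom := by
        rw [h₁] at hx
        rwa [← h₃, ← hx.mem_iff, h₂]
      refine Env.AlphaUnder.lookup h.2 hs.1 hs'.1 hx ?_ ?_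
      · rw [← not_not (a := some x ∈ E.dom), ← Env.lookup_eq_none_iff] at hE
        rw [Env.lookup] at hv
        split at hv <;> simp_all
      · rw [← not_not (a := some x' ∈ E'.dom), ← Env.lookup_eq_none_iff] at hE'
        rw [Env.lookup] at hv'
        split at hv' <;> simp_all
    · have hE' : some x' ∉ E'.dom := by
        rw [h₁] at hx
        rwa [← h₃, ← hx.mem_iff, h₂]
      rw [Env.lookup, Env.lookup_eq_none_iff.2 hE] at hv
      rw [Env.lookup, Env.lookup_eq_none_iff.2 hE'] at hv'
      obtain rfl : b = v := by
        by_cases hz : z = x <;> simp_all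
      obtain rfl : b' = v' := by
        by_cases hz : z' = x' <;> simp_all
      refine h.1.mono fun a ha c hc hac => ?_
      have hsa : some a ∉ L ++ (E.dom ++ [some z]) := fun hm => hs.2 a hm ha
      have hsc : some c ∉ L' ++ (E'.dom ++ [some z']) := fun hm => hs'.2 c hm hc
      simp only [List.mem_append, List.mem_singleton, Option.some.injEq, not_or] at hsa hsc
      rw [h₁, varEq_append_iff (by rw [h₂]; exact hsa.2.1) (by rw [h₃]; exact hsc.2.1)]
      exact Or.inr ⟨hsa.2.2, hsc.2.2, hac⟩
  | .snoc _ _ _, .nil, _, h, _, _, _, _, _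
  | .snoc _ none _, .snoc _ (some _) _, _, h, _, _, _, _, _
  | .snoc _ (some _) _, .snoc _ none _, _, h, _, _, _, _, _ => by
    simp [Env.AlphaUnder] at h

/-! ### Invariants of the reachable states -/

/-- The two variables of a principal history entry belong to the domain `D`. -/
def HistEntry.BoundIn (D : List Target) : HistEntry → Prop
  | .search => True
  | .principal x y => some x ∈ D ∧ some y ∈ D

theorem HistEntry.BoundIn.mono {D D' : List Target} (h : D ⊆ D') :
    ∀ {e : HistEntry}, e.BoundIn D → e.BoundIn D'
  | .search, _ => trivial
  | .principal _ _, he => ⟨h he.1, h he.2⟩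

/-- The properties of states that forward transitions preserve. -/
structure State.Invariant (S : State) : Prop where
  isVEnv : S.evaluated.IsVEnv
  wellNamed : (readBack S).WellNamed
  isClosed : (readBack S).IsClosed
  hist : ∀ e ∈ S.hist, e.BoundIn S.evaluated.dom

theorem Env.dom_cons (z : Target) (b : Bite) (E : Env) : (Env.cons z b E).dom = z :: E.dom := by
  simp [Env.cons, Env.single, Env.dom_append, Env.dom]

theorem Env.isVEnv_cons {z : Target} {b : Bite} {E : Env} (hb : b.IsValue) (hE : E.IsVEnv) :
    (Env.cons z b E).IsVEnv :=
  (Env.isVEnv_append _ _).2 ⟨⟨trivial, hb⟩, hE⟩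

theorem Env.isClosed_append {A B : Env} :
    (A.append B).IsClosed ↔ B.IsClosed ∧ ∀ a ∈ A.fv, some a ∈ B.dom := by
  simp only [Env.IsClosed, Finset.eq_empty_iff_forall_notMem, Env.mem_fv_append]
  grind

theorem Env.IsClosed.mem_dom_of_lookup {x a : Var} {b : Bite} {E : Env} (hE : E.IsClosed)
    (h : E.lookup x = some b) (ha : a ∈ b.fv) : some a ∈ E.dom := by
  rcases Env.mem_fv_of_lookup h ha with h' | h'
  · rw [hE] at h'; simp at h'
  · exact h'

/-- The rule `m₁` preserves closedness: the free variables of the unfolded body are the argument and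
free variables of a bite of `Ev`, all of them in the domain of `Ev`. -/
theorem Env.isClosed_of_m1Side {E₁ : Env} {z : Target} {x y : Var} {Ev : Env} {b' : Bite} {E' : Env}
    (hc : ((E₁.snoc z (.app x y)).append Ev).IsClosed) (h : M1Side E₁ z x y Ev b' E') :
    (((E₁.snoc z b').append E').append Ev).IsClosed := by
  rw [Env.isClosed_append] at hc ⊢
  refine ⟨hc.1, fun a ha => ?_⟩
  obtain ⟨v, x₁, b, E, hv, hα, -, -, hsub, -⟩ := h
  have hbody : ∀ a ∈ (Env.cons none b' E').fv, some a ∈ Ev.dom := by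
    intro a ha
    rw [← hsub] at ha
    rcases Env.mem_fv_subst ha with rfl | ⟨ha, hne⟩
    · exact hc.2 a (by simp [Env.mem_fv_snoc, Bite.fv])
    · obtain ⟨c, hcv, hca⟩ := Bite.AlphaUnder.exists_mem_fv hα a (by simp [Bite.fv, ha, hne])
      obtain rfl : c = a := hca
      exact hc.1.mem_dom_of_lookup hv hcv
  rw [Env.cons] at hbody
  have h₁ := hc.2 a
  have h₂ := hbody a
  simp only [Env.mem_fv_append, Env.mem_fv_snoc, Env.single] at ha h₁ h₂
  tauto

theorem Env.isClosed_replace_app {A : Env} {z : Target} {x y u : Var} {w : Bite} {Ev : Env}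
    (h : ((A.snoc z (.app x y)).append Ev).IsClosed) (hw : Ev.lookup u = some w) :
    ((A.snoc z w).append Ev).IsClosed := by
  rw [Env.isClosed_append] at h ⊢
  refine ⟨h.1, fun a ha => ?_⟩
  rw [Env.mem_fv_snoc] at ha
  rcases ha with ha | ha
  · exact h.2 a (Env.mem_fv_snoc.2 (.inl ha))
  · exact h.1.mem_dom_of_lookup hw ha

theorem State.Invariant.boundIn_principal {E₁ Ev : Env} {z : Target} {x y : Var}
    {H : List HistEntry} (h : State.Invariant ⟨E₁.snoc z (.app x y), Ev, H⟩) :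
    (HistEntry.principal x y).BoundIn Ev.dom := by
  have := (Env.isClosed_append.1 h.isClosed).2
  exact ⟨this x (by simp [Env.mem_fv_snoc, Bite.fv]), this y (by simp [Env.mem_fv_snoc, Bite.fv])⟩

theorem State.Invariant.step {S S' : State} (hS : S.Invariant)
    (h : Principal S S' ∨ Overhead S S') : S'.Invariant := by
  rcases h with (h | h) | h
  · obtain ⟨E₁, z, x, y, Ev, b', E', H, hv, hm⟩ := h
    refine ⟨hS.isVEnv, ?_, Env.isClosed_of_m1Side hS.isClosed hm,
      List.forall_mem_cons.2 ⟨hS.boundIn_principal, hS.hist⟩⟩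
    obtain ⟨-, -, -, -, -, -, -, -, -, hw⟩ := hm
    exact hw
  · obtain ⟨E₁, z, x, y, Ev, w, H, hv, x₁, y₁, hl, hw⟩ := h
    refine ⟨Env.isVEnv_cons (hv.isValue_of_lookup hw) hv, ?_, ?_, ?_⟩
    · rw [readBack, Env.append_cons]
      exact hS.wellNamed.replace_app hw
    · rw [readBack, Env.append_cons]
      exact Env.isClosed_replace_app hS.isClosed hw
    · simp only [Env.dom_cons]
      exact fun e he => HistEntry.BoundIn.mono (List.subset_cons_self _ _)
        (List.forall_mem_cons.2 ⟨hS.boundIn_principal, hS.hist⟩ e he)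
  · obtain ⟨E₁, z, v, Ev, H, hv, hval⟩ := h
    refine ⟨Env.isVEnv_cons hval hv, ?_, ?_, ?_⟩
    · rw [readBack, Env.append_cons]
      exact hS.wellNamed
    · rw [readBack, Env.append_cons]
      exact hS.isClosed
    · simp only [Env.dom_cons]
      exact fun e he => HistEntry.BoundIn.mono (List.subset_cons_self _ _)
        (List.forall_mem_cons.2 ⟨trivial, hS.hist⟩ e he)

theorem FwdReachable.invariant {S : State} (h : FwdReachable S) : S.Invariant := by
  obtain ⟨E, ⟨-, hc, hw⟩, h⟩ := h
  induction h with
  | refl => exact ⟨trivial, hw, hc, by simp [initState]⟩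
  | tail _ hstep ih => exact ih.step hstep

theorem State.Invariant.scopedFrom_evaluated {S : State} (h : S.Invariant) :
    S.evaluated.ScopedFrom ([] ++ S.active.dom) :=
  ((Env.scopedFrom_append _ _ _).1 (Env.wellNamed_iff.1 h.wellNamed).2.2).2

theorem State.Invariant.notMem_dom {E₁ Ev : Env} {z : Target} {b : Bite} {H : List HistEntry}
    (h : State.Invariant ⟨E₁.snoc z b, Ev, H⟩) : z ∉ Ev.dom := by
  have := h.wellNamed.nodup
  rw [readBack, Env.dom_append, List.nodup_append] at this
  exact fun hz => this.2.2 z (by simp [Env.dom]) z hz rfl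

/-! ### Determinism up to α-equivalence -/

theorem HistEntry.AlphaUnder.cons {Γ : List (Var × Var)} {z z' : Var} {D D' : List Target}
    (hz : some z ∉ D) (hz' : some z' ∉ D') : ∀ {e e' : HistEntry}, e.BoundIn D → e'.BoundIn D' →
      e.AlphaUnder Γ e' → e.AlphaUnder ((z, z') :: Γ) e'
  | .search, .search, _, _, _ => trivial
  | .principal x y, .principal x' y', hb, hb', h => by
    refine ⟨Or.inr ⟨?_, ?_, h.1⟩, Or.inr ⟨?_, ?_, h.2⟩⟩
    · rintro rfl; exact hz hb.1
    · rintro rfl; exact hz' hb'.1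
    · rintro rfl; exact hz hb.2
    · rintro rfl; exact hz' hb'.2

/-- Moving the rightmost entry of the active environment, with α-equivalent bites, to the evaluated
environment, and pushing matching history entries, respects α-equivalence. The new target is fresh
for the history, as the variables of the latter are bound in the evaluated environment. -/
theorem State.AlphaEq.push {E₁ E₁' Ev Ev' : Env} {z z' : Target} {c c' w w' : Bite}
    {H H' : List HistEntry} {e e' : HistEntry}
    (h : State.AlphaEq ⟨E₁.snoc z c, Ev, H⟩ ⟨E₁'.snoc z' c', Ev', H'⟩)
    (hw : w.AlphaUnder (Ev.pairing [] Ev') w')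
    (he : e.AlphaUnder (Ev.pairing [] Ev') e')
    (hz : z ∉ Ev.dom) (hz' : z' ∉ Ev'.dom)
    (hH : ∀ f ∈ e :: H, f.BoundIn Ev.dom) (hH' : ∀ f ∈ e' :: H', f.BoundIn Ev'.dom) :
    State.AlphaEq ⟨E₁, Env.cons z w Ev, e :: H⟩ ⟨E₁', Env.cons z' w' Ev', e' :: H'⟩ := by
  obtain ⟨h₁, h₂, h₃⟩ := h
  simp only at h₁ h₂ h₃
  have h₄ := List.Forall₂.cons he h₃
  rcases z with _ | z <;> rcases z' with _ | z'
  · rw [Env.AlphaUnder] at h₂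
    have := Env.AlphaUnder.append (A := Env.single none w) (A' := Env.single none w') h₁
      (by simp only [Env.single, Env.AlphaUnder]; exact ⟨hw, trivial⟩)
    refine ⟨this.1, ?_, ?_⟩
    · simp only [Env.cons]
      rw [this.2]
      exact h₂.2
    · simp only [Env.cons]
      rw [this.2]
      exact h₄
  · simp [Env.AlphaUnder] at h₂
  · simp [Env.AlphaUnder] at h₂
  · rw [Env.AlphaUnder] at h₂
    have := Env.AlphaUnder.append (A := Env.single (some z) w) (A' := Env.single (some z') w') h₁
      (by simp only [Env.single, Env.AlphaUnder]; exact ⟨hw, trivial⟩)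
    refine ⟨this.1, ?_, ?_⟩
    · simp only [Env.cons]
      rw [this.2]
      exact h₂.2
    · simp only [Env.cons]
      rw [this.2]
      rw [List.forall₂_iff_get] at h₄ ⊢
      exact ⟨h₄.1, fun i hi hi' => (h₄.2 i hi hi').cons hz hz' (hH _ (List.get_mem _ _))
        (hH' _ (List.get_mem _ _))⟩

/-- The rightmost bites of α-equivalent active environments are α-equivalent. -/
theorem State.AlphaEq.bite {E₁ E₁' Ev Ev' : Env} {z z' : Target} {c c' : Bite}
    {H H' : List HistEntry} (h : State.AlphaEq ⟨E₁.snoc z c, Ev, H⟩ ⟨E₁'.snoc z' c', Ev', H'⟩) :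
    c.AlphaUnder (Ev.pairing [] Ev') c' := by
  have h₂ := h.2.1
  rcases z with _ | z <;> rcases z' with _ | z' <;> simp only [Env.AlphaUnder] at h₂
  · exact h₂.1
  · exact h₂.1

theorem Bite.AlphaUnder.isValue_iff : ∀ {b b' : Bite} {Γ : List (Var × Var)}, b.AlphaUnder Γ b' →
    (b.IsValue ↔ b'.IsValue)
  | .app x y, .app x' y', Γ, h | .constAbs x y, .constAbs x' y', Γ, h
  | .abs x E, .abs x' E', Γ, h => by simp [Bite.IsValue]
  | .app _ _, .constAbs _ _, _, h | .app _ _, .abs _ _, _, h | .constAbs _ _, .app _ _, _, h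
  | .constAbs _ _, .abs _ _, _, h | .abs _ _, .app _ _, _, h | .abs _ _, .constAbs _ _, _, h => by
    simp [Bite.AlphaUnder] at h

theorem State.AlphaEq.lookup {S S' : State} (hS : S.Invariant) (hS' : S'.Invariant)
    (h : S.AlphaEq S') {x x' : Var} {v v' : Bite}
    (hx : VarEq (S.evaluated.pairing [] S'.evaluated) x x')
    (hv : S.evaluated.lookup x = some v) (hv' : S'.evaluated.lookup x' = some v') :
    v.AlphaUnder (S.evaluated.pairing [] S'.evaluated) v' :=
  h.1.lookup hS.scopedFrom_evaluated hS'.scopedFrom_evaluated hx hv hv'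

theorem State.AlphaEq.sea {S₁ S₂ S₁' S₂' : State} (hS₁ : S₁.Invariant) (hS₂ : S₂.Invariant)
    (h : S₁.AlphaEq S₂) (h₁ : Sea S₁ S₁') (h₂ : Sea S₂ S₂') : S₁'.AlphaEq S₂' := by
  obtain ⟨E₁, z, v, Ev, H, hv, hval⟩ := h₁
  obtain ⟨E₁', z', v', Ev', H', hv', hval'⟩ := h₂
  exact h.push h.bite trivial hS₁.notMem_dom hS₂.notMem_dom
    (List.forall_mem_cons.2 ⟨trivial, hS₁.hist⟩) (List.forall_mem_cons.2 ⟨trivial, hS₂.hist⟩)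

theorem State.AlphaEq.m2 {S₁ S₂ S₁' S₂' : State} (hS₁ : S₁.Invariant) (hS₂ : S₂.Invariant)
    (h : S₁.AlphaEq S₂) (h₁ : M2 S₁ S₁') (h₂ : M2 S₂ S₂') : S₁'.AlphaEq S₂' := by
  obtain ⟨E₁, z, x, y, Ev, w, H, hv, x₁, y₁, hl, hw⟩ := h₁
  obtain ⟨E₁', z', x', y', Ev', w', H', hv', x₁', y₁', hl', hw'⟩ := h₂
  have hb := h.bite
  rw [Bite.AlphaUnder] at hb
  have hα := h.lookup hS₁ hS₂ hb.1 hl hl'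
  rw [Bite.AlphaUnder] at hα
  have hy : VarEq (Ev.pairing [] Ev') (substVar x₁ y y₁) (substVar x₁' y' y₁') := by
    rcases hα with ⟨rfl, rfl⟩ | ⟨hne, hne', hα⟩
    · simpa [substVar] using hb.2
    · simpa [substVar, hne, hne'] using hα
  exact h.push (h.lookup hS₁ hS₂ hy hw hw') hb hS₁.notMem_dom hS₂.notMem_dom
    (List.forall_mem_cons.2 ⟨hS₁.boundIn_principal, hS₁.hist⟩)
    (List.forall_mem_cons.2 ⟨hS₂.boundIn_principal, hS₂.hist⟩)

/-- Fresh pairs of variables may be inserted between the target of an entry and the pairing below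
which the environment on its left is compared. -/
theorem Env.AlphaUnder.replace_bite {E₁ E₁' : Env} {z z' : Target} {c c' b b' : Bite}
    {Γ Θ : List (Var × Var)} (h : (E₁.snoc z c).AlphaUnder Γ (E₁'.snoc z' c'))
    (hΘ : ∀ a ∈ E₁.fv, a ∉ Θ.map Prod.fst) (hΘ' : ∀ a ∈ E₁'.fv, a ∉ Θ.map Prod.snd)
    (hb : b.AlphaUnder (Θ ++ Γ) b') : (E₁.snoc z b).AlphaUnder (Θ ++ Γ) (E₁'.snoc z' b') := by
  rcases z with _ | z <;> rcases z' with _ | z' <;> simp only [Env.AlphaUnder] at h ⊢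
  · refine ⟨hb, h.2.mono fun a ha c hc hac => ?_⟩
    rwa [varEq_append_iff (hΘ a ha) (hΘ' c hc)]
  · refine ⟨hb, h.2.mono fun a ha c hc hac => ?_⟩
    rw [VarEq] at hac ⊢
    rwa [varEq_append_iff (hΘ a ha) (hΘ' c hc)]

theorem State.AlphaEq.m1 {S₁ S₂ S₁' S₂' : State} (hS₁ : S₁.Invariant) (hS₂ : S₂.Invariant)
    (h : S₁.AlphaEq S₂) (h₁ : M1 S₁ S₁') (h₂ : M1 S₂ S₂') : S₁'.AlphaEq S₂' := by
  obtain ⟨E₁, z, x, y, Ev, b', E', H, hv, v, x₁, b, E, hl, hα, hfr, hy, hsub, -⟩ := h₁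
  obtain ⟨F₁, t, r, s, Fv, c', F', I, hw, w, r₁, c, F, hl', hα', hfr', hy', hsub', -⟩ := h₂
  have hb := h.bite
  rw [Bite.AlphaUnder] at hb
  have hlam := (h.lookup hS₁ hS₂ hb.1 hl hl').congr hα hα'
  rw [Bite.AlphaUnder] at hlam
  have hbody := Env.AlphaUnder.subst (Δ := Ev.pairing [] Fv) (x := x₁) (y := y) (x' := r₁) (y' := s)
    hlam (.inr hy) (.inr hy') (by
      rintro a - d - (⟨rfl, rfl⟩ | ⟨hne, hne', had⟩)
      · simpa [substVar] using hb.2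
      · simpa [substVar, hne, hne'] using had)
  rw [hsub, hsub'] at hbody
  obtain ⟨hE, hbc⟩ := hbody.of_cons_none
  obtain ⟨Θ, h₁, h₂, h₃⟩ := hE.exists_pairing
  have hdom : E'.dom = E.dom := by
    have := congrArg Env.dom hsub
    rw [Env.dom_subst, Env.dom_cons, Env.dom_cons] at this
    exact (List.cons.inj this).2.symm
  have hdom' : F'.dom = F.dom := by
    have := congrArg Env.dom hsub'
    rw [Env.dom_subst, Env.dom_cons, Env.dom_cons] at this
    exact (List.cons.inj this).2.symm
  have hvars : ∀ (A : Env) (z : Target) (b : Bite) (B : Env) (a : Var), a ∈ A.fv →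
      a ∈ ((A.snoc z b).append B).vars := fun A z b B a ha =>
    Env.vars_subset_append _ _ (by rw [Env.vars]; simp [Env.fv_subset_vars A ha])
  rw [h₁] at hbc
  -- The evaluated environments are unchanged, so the history is compared below the same pairing.
  refine ⟨h.1, ?_, .cons hb h.2.2⟩
  refine (Env.AlphaUnder.append hE ?_).1
  rw [h₁]
  refine Env.AlphaUnder.replace_bite h.2.1 (fun a ha hm => ?_) (fun a ha hm => ?_) hbc
  · rw [h₂, hdom] at hm
    exact hfr a hm (hvars _ _ _ _ a ha)
  · rw [h₃, hdom'] at hm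
    exact hfr' a hm (hvars _ _ _ _ a ha)

theorem Bite.AlphaEq.exists_eq_abs : ∀ {v : Bite} {x : Var} {E : Env}, v.AlphaEq (.abs x E) →
    ∃ (x' : Var) (E' : Env), v = .abs x' E'
  | .abs x' E', _, _, _ => ⟨x', E', rfl⟩
  | .app _ _, _, _, h | .constAbs _ _, _, _, h => by simp [Bite.AlphaEq, Bite.AlphaUnder] at h

/-- The rules `m₁` and `m₂` exclude each other, also on α-equivalent states: they apply to different
kinds of abstractions. -/
theorem State.AlphaEq.not_m1_m2 {S₁ S₂ S₁' S₂' : State} (hS₁ : S₁.Invariant) (hS₂ : S₂.Invariant)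
    (h : S₁.AlphaEq S₂) (h₁ : M1 S₁ S₁') (h₂ : M2 S₂ S₂') : False := by
  obtain ⟨E₁, z, x, y, Ev, b', E', H, hv, v, x₁, b, E, hl, hα, -⟩ := h₁
  obtain ⟨F₁, z', x', y', Ev', w', H', hv', x₁', y₁', hl', hw'⟩ := h₂
  have hb := h.bite
  rw [Bite.AlphaUnder] at hb
  obtain ⟨u, C, rfl⟩ := hα.exists_eq_abs
  simpa [Bite.AlphaUnder] using h.lookup hS₁ hS₂ hb.1 hl hl'

theorem State.AlphaEq.not_principal_sea {S₁ S₂ S₁' S₂' : State} (h : S₁.AlphaEq S₂)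
    (h₁ : Principal S₁ S₁') (h₂ : Sea S₂ S₂') : False := by
  obtain ⟨F₁, t, v, Fv, I, -, hval⟩ := h₂
  rcases h₁ with h₁ | h₁
  · obtain ⟨E₁, z, x, y, Ev, b', E', H, -, -⟩ := h₁
    exact h.bite.isValue_iff.2 hval
  · obtain ⟨E₁, z, x, y, Ev, w, H, -, -⟩ := h₁
    exact h.bite.isValue_iff.2 hval

theorem State.AlphaEq.step {S₁ S₂ S₁' S₂' : State} (hS₁ : S₁.Invariant) (hS₂ : S₂.Invariant)
    (h : S₁.AlphaEq S₂) (h₁ : Principal S₁ S₁' ∨ Overhead S₁ S₁')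
    (h₂ : Principal S₂ S₂' ∨ Overhead S₂ S₂') : S₁'.AlphaEq S₂' := by
  rcases h₁ with h₁ | h₁ <;> rcases h₂ with h₂ | h₂
  · rcases h₁ with h₁ | h₁ <;> rcases h₂ with h₂ | h₂
    · exact h.m1 hS₁ hS₂ h₁ h₂
    · exact (h.not_m1_m2 hS₁ hS₂ h₁ h₂).elim
    · exact (h.symm.not_m1_m2 hS₂ hS₁ h₂ h₁).elim
    · exact h.m2 hS₁ hS₂ h₁ h₂
  · exact (h.not_principal_sea h₁ h₂).elim
  · exact (h.symm.not_principal_sea h₂ h₁).elim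
  · exact h.sea hS₁ hS₂ h₁ h₂

/-! ### Read-back and termination -/

theorem Principal.crStep {S S' : State} (h : Principal S S') :
    CrStep (readBack S) (readBack S') := by
  rcases h with h | h
  · obtain ⟨E₁, z, x, y, Ev, b', E', H, hv, hm⟩ := h
    exact Or.inl (.step _ _ _ _ _ _ _ hv hm)
  · obtain ⟨E₁, z, x, y, Ev, w, H, hv, hm⟩ := h
    rw [readBack, readBack, Env.append_cons]
    exact Or.inr (.step _ _ _ _ _ _ hv hm)

theorem Sea.readBack_eq {S S' : State} (h : Sea S S') : readBack S = readBack S' := by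
  obtain ⟨E₁, z, v, Ev, H, hv, hval⟩ := h
  exact (Env.append_cons _ _ _ _).symm

/-- A reduction step of the read-back contracts its rightmost application. Either this is the
rightmost entry of the active environment, and the machine takes the same step, or that entry is a
value, and the machine searches further. -/
theorem State.exists_step_of_crStep {S : State} (hS : S.evaluated.IsVEnv) {t : Env}
    (h : CrStep (readBack S) t) : ∃ S', Principal S S' ∨ Overhead S S' := by
  obtain ⟨A, Ev, H⟩ := S
  rcases A with _ | ⟨E₁, z, c⟩
  -- With an empty active environment the read-back is a v-environment, so no rule applies.
  · have hF : (readBack ⟨.nil, Ev, H⟩).IsVEnv := (Env.isVEnv_append _ _).2 ⟨trivial, hS⟩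
    generalize readBack ⟨.nil, Ev, H⟩ = F at h hF
    rcases h with h | h <;> cases h <;> exact absurd hF Env.not_isVEnv_append_app
  rcases c with ⟨x, y⟩ | ⟨x, y⟩ | ⟨x, E⟩
  · generalize hF : readBack ⟨E₁.snoc z (.app x y), Ev, H⟩ = F at h
    rcases h with h | h
    · obtain ⟨A, w, u, v, C, b', E', hC, hm⟩ := h
      obtain ⟨rfl, rfl, rfl, rfl, rfl⟩ := Env.append_app_inj hS hC hF
      exact ⟨_, .inl (.inl (.step _ _ _ _ _ _ _ _ hS hm))⟩
    · obtain ⟨A, w, u, v, C, b', hC, hm⟩ := h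
      obtain ⟨rfl, rfl, rfl, rfl, rfl⟩ := Env.append_app_inj hS hC hF
      exact ⟨_, .inl (.inr (.step _ _ _ _ _ _ _ hS hm))⟩
  · exact ⟨_, .inr (.step _ _ _ _ _ hS trivial)⟩
  · exact ⟨_, .inr (.step _ _ _ _ _ hS trivial)⟩

theorem Sea.length_dom_active {S S' : State} (h : Sea S S') :
    S'.active.dom.length < S.active.dom.length := by
  obtain ⟨E₁, z, v, Ev, H, hv, hval⟩ := h
  simp [Env.dom]

end RCAM

theorem mainTheorem3 :
    RCAM.IsImplementationSystem RCAM.IsSource RCAM.CrStep RCAM.FwdReachable RCAM.stateSetoid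
      RCAM.Principal RCAM.Overhead RCAM.initState RCAM.readBack where
  initialization E hE := ⟨⟨E, hE, .refl⟩, rfl⟩
  principal_projection _ _ _ h := h.crStep
  overhead_transparency _ _ _ h := h.readBack_eq
  determinism _ _ _ _ h₁ h₂ h hs₁ hs₂ :=
    RCAM.State.AlphaEq.step h₁.invariant h₂.invariant h hs₁ hs₂
  halt _ hS hn _ ht := by
    obtain ⟨S', h⟩ := RCAM.State.exists_step_of_crStep hS.invariant.isVEnv ht
    exact hn S' h
  overhead_termination := by
    rintro ⟨f, -, hf⟩
    exact not_strictAnti_of_wellFoundedLT (fun n => (f n).active.dom.length)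
      (strictAnti_nat_of_succ_lt fun n => RCAM.Sea.length_dom_active (hf n))
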